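/- **Setting.** An environment consists of $m\ge 1$ infinite rays $0,\dots,m-1$ with common origin $O$. An instance $I$ of weighted search consists of a required weight $W_I\ge 0$ and, for each ray $i$, a distance $d_i\in[1,\infty]$ and a weight $w_i\ge 0$ of the target on ray $i$, where $d_i=\infty$, $w_i=0$ means that ray $i$ has no target, and where $\sum_i w_i\ge W_I$. Let $T_I=\{i: d_i<\infty\}$, $w_{\max,I}=\max_i w_i$, and $$opt(I)=\min\Big\{2\sum_{i\in S}d_i-\max_{i\in S}d_i \;:\; S\subseteq T_I,\ \sum_{i\in S}w_i\ge W_I\Big\}$$ (the cost of $S=\emptyset$ is $0$). A (deterministic) strategy $\Sigma$ chooses, each time the searcher is at $O$, a ray $r$ whose target has not been found yet and a depth $l\ge 0$, as a function of everything observed so far and possibly of $W_I$; the depth is finite unless $r$ is the only such ray left, in which case $l=\infty$ is also allowed. The searcher then traverses $r$ up to depth $l$ and returns to $O$; if it meets the target of $r$ on the way (that is, if $d_r\le l$), it learns its distance and weight and returns to $O$ at once. The cost $c(\Sigma,I)$ is the distance traversed until the first time that targets of total weight at least $W_I$ have been found ($\infty$ if this never happens). The strategy $\mathsf{AdSch}$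 keeps a list of the rays whose target has not been found, in their original cyclic order, a current ray in this list, and a number $D$; initially the current ray is ray $0$ and $D=1$. With $k$ rays in the list let $b=1+\frac1{k-1}$ ($b=\infty$ if $k=1$). It searches the current ray up to distance $D\cdot b$ or until a target is found. If no target is found, then $D$ is replaced by $D\cdot b$ and the cyclically next ray in the list becomes current; if a target is found, then the ray is removed from the list, the ray after it becomes current, and $D$ is unchanged. This is repeated until the weight found is at least $W_I$. Let $\phi(x)=1+2(1+x)\left(1+\frac1x\right)^x$ for $x>0$. **Theorem.** (Upper bounds.) Let $I$ be an instance on $m\ge 1$ rays with $w_{\max,I}>0$. If $\lceil W_I/w_{\max,I}\rceil<m$, then $$c(\mathsf{AdSch},I)\le \phi\big(m-\lceil W_I/w_{\max,I}\rceil\big)\cdot opt(I),$$ and otherwise $c(\mathsf{AdSch},I)\le(3+2e)\cdot opt(I)$. (Lower bounds.) Let $m\ge 2$, and let $\Sigma$ be any strategy. For every $t\in\{1,\dots,m-1\}$ and every $\varepsilon>0$ there is an instance $I$ on $m$ rays with $w_{\max,I}>0$, $W_I/w_{\max,I}<m$ and $\lceil W_I/w_{\max,I}\rceil=t$ such that $$c(\Sigma,I)\ge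 \Big(\phi\big(m-\lceil W_I/w_{\max,I}\rceil\big)-\varepsilon\Big)\cdot opt(I).$$ Moreover, there is an instance $I$ on $m$ rays with $w_{\max,I}>0$ and $W_I/w_{\max,I}=m$ such that $c(\Sigma,I)\ge 2\cdot opt(I)$. -/

import Mathlib

open scoped NNReal ENNReal

namespace WeightedSearch

noncomputable section

/-- The function `φ(x) = 1 + 2 (1 + x) (1 + 1/x)^x` (used for `x > 0`). -/
def phi (x : ℝ) : ℝ := 1 + 2 * (1 + x) * (1 + 1 / x) ^ x

/-- An instance of weighted search on `m` rays: the required weight `W` and, for each ray, the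
distance `d i ≥ 1` and the weight `w i ≥ 0` of its target. A ray without a target is encoded by
`d i = ∞` and `w i = 0`. The targets present have total weight at least `W`. -/
structure Inst (m : ℕ) where
  W : ℝ≥0
  d : Fin m → ℝ≥0∞
  w : Fin m → ℝ≥0
  one_le_d : ∀ i, 1 ≤ d i
  w_eq_zero : ∀ i, d i = ⊤ → w i = 0
  feasible : W ≤ ∑ i, w i

namespace Inst

variable {m : ℕ} (I : Inst m)

/-- The largest target weight. -/
def wMax : ℝ≥0 := Finset.univ.sup I.w

/-- The rays that carry a target. -/
def targets : Finset (Fin m) := {i | I.d i ≠ ⊤}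

/-- The full-information cost `2 ∑_{i ∈ S} d_i - max_{i ∈ S} d_i` of visiting a set `S` of targets
(for `S ⊆ I.targets` all the quantities are finite, and the cost is `0` if `S = ∅`). -/
def setCost (S : Finset (Fin m)) : ℝ≥0∞ := 2 * ∑ i ∈ S, I.d i - S.sup I.d

/-- The optimal cost: the least `setCost S` over the sets `S` of targets of weight at least `W`. -/
def opt : ℝ≥0∞ := {S ∈ I.targets.powerset | I.W ≤ ∑ i ∈ S, I.w i}.inf I.setCost

end Inst

/-- What the searcher knows of one completed exploration: the ray, the depth up to which it
intended to search the ray, and the distance and the weight of the target if one was found. -/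
structure Exploration (m : ℕ) where
  ray : Fin m
  depth : ℝ≥0∞
  found : Option (ℝ≥0∞ × ℝ≥0)

/-- The explorations made so far, the most recent one first. -/
abbrev History (m : ℕ) := List (Exploration m)

/-- The rays whose target has been found. -/
def foundRays {m : ℕ} : History m → Finset (Fin m)
  | [] => ∅
  | e :: h => if e.found.isSome then insert e.ray (foundRays h) else foundRays h

/-- The total weight of the targets found. -/
def foundWeight {m : ℕ} (h : History m) : ℝ≥0 :=
  (h.map fun e => (e.found.map Prod.snd).getD 0).sum

/-- A (deterministic, adaptive) search strategy. Whenever the searcher is at the origin, it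
chooses the next ray and the depth of the search on it as a function of everything observed so far
(and possibly of `W`). A ray whose target has been found is not searched again, and the depth is
finite, so that the searcher is sure to return, unless only one ray is left. -/
structure Strategy (m : ℕ) where
  next : ℝ≥0 → History m → Fin m × ℝ≥0∞
  ray_notMem : ∀ W h, foundRays h ≠ Finset.univ → (next W h).1 ∉ foundRays h
  depth_ne_top : ∀ W h, (∃ i, i ∉ foundRays h ∧ i ≠ (next W h).1) → (next W h).2 ≠ ⊤

namespace Strategy

variable {m : ℕ} (A : Strategy m) (I : Inst m)

/-- The exploration that follows the history `h` on the instance `I`. -/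
def explore (h : History m) : Exploration m :=
  let i := (A.next I.W h).1
  let l := (A.next I.W h).2
  { ray := i
    depth := l
    found := if I.d i ≤ l ∧ I.d i ≠ ⊤ then some (I.d i, I.w i) else none }

/-- The first `n` explorations on the instance `I`. -/
def run : ℕ → History m
  | 0 => []
  | n + 1 => A.explore I (run n) :: run n

end Strategy

/-- How far from the origin the searcher gets during an exploration. -/
def reach {m : ℕ} (I : Inst m) (e : Exploration m) : ℝ≥0∞ := min e.depth (I.d e.ray)

/-- The distance traversed until the searcher is at the extreme point of its last exploration:
each earlier exploration is traversed in both directions, the last one only outwards. -/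
def travel {m : ℕ} (I : Inst m) : History m → ℝ≥0∞
  | [] => 0
  | e :: h => reach I e + 2 * (h.map (reach I)).sum

open Classical in
/-- The cost of a strategy on an instance: the distance traversed until the first time that
targets of total weight at least `W` have been found (`∞` if this never happens). -/
def Strategy.cost {m : ℕ} (A : Strategy m) (I : Inst m) : ℝ≥0∞ :=
  if h : ∃ n, I.W ≤ foundWeight (A.run I n) then travel I (A.run I (Nat.find h)) else ⊤

/-! ### The strategy AdSch -/

/-- The state of AdSch: the remaining rays in their canonical order, the label `r` of the current
ray among them, and the length `D`. If `f - 1` targets have been found, then `m - f + 1` rays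
remain, so that `f` need not be stored. -/
structure AdState (m : ℕ) where
  rays : List (Fin m)
  r : ℕ
  D : ℝ≥0∞

namespace AdState

variable {m : ℕ}

/-- The factor `b_{m,f} = 1 + 1 / (m - f)`, where `m - f + 1` rays remain; it is `∞` if only one
ray remains. -/
def b (s : AdState m) : ℝ≥0∞ := 1 + ((s.rays.length - 1 : ℕ) : ℝ≥0∞)⁻¹

/-- Initially all the rays are present, `r = 0` and `D = 1`. -/
def init (m : ℕ) : AdState m := ⟨List.finRange m, 0, 1⟩

/-- The update after an exploration. If no target was found, move on to the next ray and multiply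
`D` by `b_{m,f}`. Otherwise remove the current ray; then label `r` is that of the ray after it. -/
def step (s : AdState m) (e : Exploration m) : AdState m :=
  if e.found.isSome then
    { rays := s.rays.erase e.ray
      r := s.r % (s.rays.erase e.ray).length
      D := s.D }
  else
    { rays := s.rays
      r := (s.r + 1) % s.rays.length
      D := s.D * s.b }

/-- The state after a history. -/
def ofHistory : History m → AdState m
  | [] => init m
  | e :: h => (ofHistory h).step e

lemma nodup_rays (h : History m) : (ofHistory h).rays.Nodup := by
  induction h with
  | nil => exact List.nodup_finRange m
  | cons e h ih =>
    simp only [ofHistory, step]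
    split_ifs
    · exact ih.erase _
    · exact ih

lemma mem_rays (h : History m) (i : Fin m) : i ∈ (ofHistory h).rays ↔ i ∉ foundRays h := by
  induction h with
  | nil => simp [ofHistory, init, foundRays]
  | cons e h ih =>
    simp only [ofHistory, step, foundRays]
    split_ifs
    · rw [(nodup_rays h).mem_erase_iff, ih]; simp
    · exact ih

lemma r_lt (h : History m) (h0 : (ofHistory h).rays ≠ []) :
    (ofHistory h).r < (ofHistory h).rays.length := by
  cases h with
  | nil => exact List.length_pos_iff.2 h0
  | cons e h =>
    simp only [ofHistory, step] at h0 ⊢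
    split_ifs at h0 ⊢ <;> exact Nat.mod_lt _ (List.length_pos_iff.2 h0)

lemma b_ne_top {s : AdState m} (hs : 1 < s.rays.length) : s.b ≠ ⊤ := by
  have h : (s.rays.length - 1 : ℕ) ≠ 0 := by omega
  refine ENNReal.add_ne_top.2 ⟨ENNReal.one_ne_top, ENNReal.inv_ne_top.2 ?_⟩
  exact_mod_cast h

lemma D_ne_top (h : History m) (h1 : 1 < (ofHistory h).rays.length) : (ofHistory h).D ≠ ⊤ := by
  induction h with
  | nil => simp [ofHistory, init]
  | cons e h ih =>
    simp only [ofHistory, step] at h1 ⊢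
    split_ifs at h1 ⊢
    · exact ih (lt_of_lt_of_le h1 List.length_erase_le)
    · exact ENNReal.mul_ne_top (ih h1) (b_ne_top h1)

end AdState

/-- The strategy AdSch: search the `r`th remaining ray up to distance `D · b_{m,f}`, or until a
target is found, and update the state as in `AdState.step`. It does not make use of `W`. -/
def adSch (m : ℕ) [NeZero m] : Strategy m where
  next _ h := ((AdState.ofHistory h).rays.getD (AdState.ofHistory h).r 0,
    (AdState.ofHistory h).D * (AdState.ofHistory h).b)
  ray_notMem _ h hf := by
    have h0 : (AdState.ofHistory h).rays ≠ [] := by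
      intro h0
      refine hf (Finset.eq_univ_iff_forall.2 fun i => ?_)
      by_contra hi
      simpa [h0] using (AdState.mem_rays h i).2 hi
    have hr := AdState.r_lt h h0
    rw [← AdState.mem_rays, List.getD_eq_getElem _ _ hr]
    exact List.getElem_mem hr
  depth_ne_top _ h := by
    rintro ⟨i, hi, hne⟩
    have hi' := (AdState.mem_rays h i).2 hi
    have hr := AdState.r_lt h (List.ne_nil_of_mem hi')
    rw [List.getD_eq_getElem _ _ hr] at hne
    have h1 : 1 < (AdState.ofHistory h).rays.length := by
      by_contra h1
      obtain ⟨k, hk, rfl⟩ := List.getElem_of_mem hi'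
      refine hne ?_
      congr 1
      omega
    exact ENNReal.mul_ne_top (AdState.D_ne_top h h1) (AdState.b_ne_top h1)

end

end WeightedSearch

/-! Upper bounds. With `k` rays left and `b = growth k`, the identity `k * b = k + b` turns `k * D`
into a potential: an unsuccessful search to depth `D * b` raises it by exactly `D * b`, so until a
target is found it dominates the total depth searched. Let `S` be a set attaining `opt`. Finding the
target of ray `a` costs at most `d a` and lowers the potential by `D`. If `a ∈ S`, both are charged
to `d a`, because a target not yet found lies beyond the last search of its ray, whence `D ≤ e * d
a` (`D_le_mul_growth_pow`). If `a ∉ S`, they go into a reserve `X`, which is controlled by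
comparison with a search on `K` rays, where `K` counts the remaining rays and the found ones outside
`S` (`growth_pow_le_add`). `SearchBound` is this invariant. It yields `travel_adSch_le`: before a
missing target `y` is found, the distance is at most `(1 + 2 * rayFactor K) * d y` plus `2 * (1 +
e)` times the found distances in `S`.

Now let `y` be the nearest missing target of `S` and `u` the number of other missing ones. Then `K =
m - |S| + 1 + u`. Each of the `u` extra rays raises `rayFactor` by at most `1 + e`
(`rayFactor_le_add`), which is charged to a missing target at least as far as `y`. Since `|S|` is at
least the rounded weight ratio, the bound follows.

Lower bounds. Place `t - 1` targets at distance 1 and a last one far away on one of the other `n + 1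
= m - t + 1` rays: this is asymptotically the classical search on `n + 1` rays. A ratio `c` forces
the partial sums `s` of the sorted record depths to satisfy `s (k + n + 1) ≤ α * (s (k + 1) - s k)`
for some `α` close to `(c - 1) / 2`. The growth rate of such a sequence could be improved without
bound unless `α` is at least the minimum `(n + 1) ^ (n + 1) / n ^ n` of `q ^ (n + 1) / (q - 1)` over
`q > 1` (`le_of_forall_le_mul_sub`). If all `m` targets are needed, the adversary hides them just
beyond everything searched so far, so that this effort is wasted. -/

namespace WeightedSearch

/-! ### Inequalities for powers of the expansion factors -/

/-- The expansion factor used by AdSch when `k` rays remain. -/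
noncomputable def growth (k : ℕ) : ℝ≥0∞ := 1 + ((k - 1 : ℕ) : ℝ≥0∞)⁻¹

lemma one_le_growth (k : ℕ) : 1 ≤ growth k := le_self_add

lemma growth_antitone {k l : ℕ} (h : k ≤ l) : growth l ≤ growth k := by
  unfold growth
  gcongr

lemma growth_add_two (n : ℕ) : growth (n + 2) = ENNReal.ofReal (1 + 1 / (n + 1)) := by
  have h : (0 : ℝ) < n + 1 := by positivity
  rw [growth, ENNReal.ofReal_add zero_le_one (by positivity), ENNReal.ofReal_one, one_div,
    ENNReal.ofReal_inv_of_pos h]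
  congr 2
  rw [show n + 2 - 1 = n + 1 by omega, ENNReal.ofReal_add (by positivity) zero_le_one]
  simp

/-- Multiplied by `D`, this says that the potential `k * D` grows by the depth of each unsuccessful
search. For `k = 1` both sides are infinite. -/
lemma mul_growth {k : ℕ} (hk : 1 ≤ k) : k * growth k = k + growth k := by
  obtain ⟨n, rfl⟩ : ∃ n, k = n + 1 := ⟨k - 1, by omega⟩
  rcases Nat.eq_zero_or_pos n with rfl | hn
  · simp [growth]
  · have h0 : (n : ℝ≥0∞) ≠ 0 := by exact_mod_cast hn.ne'
    have h1 : (n : ℝ≥0∞) * (n : ℝ≥0∞)⁻¹ = 1 := ENNReal.mul_inv_cancel h0 (by simp)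
    simp only [growth, Nat.add_sub_cancel, mul_add, mul_one, Nat.cast_add, Nat.cast_one, add_mul,
      one_mul, h1]

lemma mul_growth_pow_succ {k : ℕ} (hk : 1 ≤ k) (n : ℕ) :
    k * growth k ^ (n + 1) = k * growth k ^ n + growth k ^ (n + 1) := by
  rw [pow_succ', ← mul_assoc, mul_growth hk, add_mul]

/-- By `mul_growth_pow_succ` both sides grow by a power of their own expansion factor, and the
factor for `k + 1` is the smaller one. -/
lemma mul_growth_pow_le {k : ℕ} (hk : 1 ≤ k) (n : ℕ) :
    (k + 1 : ℕ) * growth (k + 1) ^ n ≤ k * growth k ^ n + 1 := by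
  induction n with
  | zero => simp
  | succ n ih =>
    rw [mul_growth_pow_succ hk, mul_growth_pow_succ (by omega), add_right_comm]
    gcongr
    exact growth_antitone (by omega)

/-- With `x = k`, the two bases have quotient `1 - 1 / x ^ 2`. Bernoulli and `p ≤ x - 1` reduce the
claim to `(1 - (x - 1) / x ^ 2) * (1 + 1 / x) = 1 + 1 / x ^ 3 ≥ 1`. -/
lemma growth_pow_le_succ {k p : ℕ} (h : p + 1 ≤ k) :
    growth k ^ p ≤ growth (k + 1) ^ (p + 1) := by
  rcases Nat.eq_zero_or_pos p with rfl | hp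
  · simpa using one_le_growth _
  obtain ⟨n, rfl⟩ : ∃ n, k = n + 2 := ⟨k - 2, by omega⟩
  rw [show n + 2 + 1 = (n + 1) + 2 by omega, growth_add_two, growth_add_two,
    ← ENNReal.ofReal_pow (by positivity), ← ENNReal.ofReal_pow (by positivity)]
  apply ENNReal.ofReal_le_ofReal
  push_cast
  set x : ℝ := (n : ℝ) + 2 with hx
  have hx2 : 2 ≤ x := by simp [hx]
  have hx1 : 0 < x - 1 := by linarith
  have e1 : (1 : ℝ) + 1 / (n + 1) = x / (x - 1) := by
    rw [show (n : ℝ) + 1 = x - 1 by rw [hx]; ring]; field_simp; ring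
  have e2 : (1 : ℝ) + 1 / (n + 1 + 1) = x / (x - 1) * (1 + -(1 / x ^ 2)) := by
    rw [show (n : ℝ) + 1 + 1 = x by rw [hx]; ring]; field_simp; ring
  have hpx : (p : ℝ) ≤ x - 1 := by
    have : ((p + 1 : ℕ) : ℝ) ≤ (n + 2 : ℕ) := by exact_mod_cast h
    push_cast at this; linarith
  have hsq : 1 / x ^ 2 ≤ 1 := by rw [div_le_one (by positivity)]; nlinarith
  have bern : 1 + (p : ℝ) * (-(1 / x ^ 2)) ≤ (1 + -(1 / x ^ 2)) ^ p :=
    one_add_mul_le_pow (by linarith) p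
  have key : 1 ≤ (1 + -(1 / x ^ 2)) ^ p * (1 + 1 / x) := by
    have : (1 - (x - 1) / x ^ 2) * (1 + 1 / x) ≤ (1 + -(1 / x ^ 2)) ^ p * (1 + 1 / x) := by
      refine mul_le_mul_of_nonneg_right (le_trans ?_ bern) (by positivity)
      have : (p : ℝ) * (1 / x ^ 2) ≤ (x - 1) * (1 / x ^ 2) := by gcongr
      have e : (x - 1) / x ^ 2 = (x - 1) * (1 / x ^ 2) := by ring
      rw [e]; linarith
    refine le_trans ?_ this
    have : (1 - (x - 1) / x ^ 2) * (1 + 1 / x) = 1 + 1 / x ^ 3 := by field_simp; ring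
    rw [this]
    have : 0 < 1 / x ^ 3 := by positivity
    linarith
  rw [pow_succ, e1]
  nth_rewrite 2 [e2]
  rw [e2, mul_pow] at *
  have e3 : x / (x - 1) * (1 + -(1 / x ^ 2)) = 1 + 1 / x := by field_simp; ring
  rw [e3, mul_assoc]
  exact le_mul_of_one_le_right (by positivity) key

lemma growth_pow_le_add {k p : ℕ} (h : p + 1 ≤ k) (e : ℕ) :
    growth k ^ p ≤ growth (k + e) ^ (p + e) := by
  induction e with
  | zero => simp
  | succ e ih => exact ih.trans (growth_pow_le_succ (by omega))

/-- Euler's number as an extended nonnegative real. -/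
noncomputable def expOne : ℝ≥0∞ := ENNReal.ofReal (Real.exp 1)

lemma expOne_ne_top : expOne ≠ ⊤ := ENNReal.ofReal_ne_top

lemma growth_pow_le_expOne {k p : ℕ} (h : p + 1 ≤ k) : growth k ^ p ≤ expOne := by
  rcases Nat.eq_zero_or_pos p with rfl | hp
  · rw [pow_zero, expOne, ← ENNReal.ofReal_one]
    exact ENNReal.ofReal_le_ofReal (Real.one_le_exp zero_le_one)
  obtain ⟨n, rfl⟩ : ∃ n, k = n + 2 := ⟨k - 2, by omega⟩
  refine (pow_le_pow_right₀ (one_le_growth _) (show p ≤ n + 1 by omega)).trans ?_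
  rw [growth_add_two, ← ENNReal.ofReal_pow (by positivity)]
  apply ENNReal.ofReal_le_ofReal
  have h0 : (0 : ℝ) < n + 1 := by positivity
  calc (1 + 1 / ((n : ℝ) + 1)) ^ (n + 1) ≤ Real.exp (1 / ((n : ℝ) + 1)) ^ (n + 1) := by
        gcongr
        rw [add_comm]; exact Real.add_one_le_exp _
    _ = Real.exp 1 := by
        rw [← Real.exp_nat_mul]; congr 1; push_cast; field_simp

/-- The factor `k^k / (k-1)^(k-1)`, in terms of `growth`. -/
noncomputable def rayFactor (k : ℕ) : ℝ≥0∞ := k * growth k ^ (k - 1)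

/-- Splitting off one power, `mul_growth_pow_le` accounts for the summand `1` and the last power is
at most `e`. -/
lemma rayFactor_succ_le {k : ℕ} (hk : 1 ≤ k) :
    rayFactor (k + 1) ≤ rayFactor k + (1 + expOne) := by
  obtain ⟨n, rfl⟩ : ∃ n, k = n + 1 := ⟨k - 1, by omega⟩
  simp only [rayFactor, Nat.add_sub_cancel]
  rw [mul_growth_pow_succ (by omega), ← add_assoc]
  exact add_le_add (mul_growth_pow_le hk n) (growth_pow_le_expOne (by omega))

lemma rayFactor_mono {k : ℕ} (hk : 1 ≤ k) : rayFactor k ≤ rayFactor (k + 1) := by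
  obtain ⟨n, rfl⟩ : ∃ n, k = n + 1 := ⟨k - 1, by omega⟩
  simp only [rayFactor, Nat.add_sub_cancel]
  exact mul_le_mul' (Nat.cast_le.2 (by omega)) (growth_pow_le_succ le_rfl)

lemma rayFactor_le_add {k l u : ℕ} (hk : 1 ≤ k) (hl : 1 ≤ l) (h : l ≤ k + u) :
    rayFactor l ≤ rayFactor k + u * (1 + expOne) := by
  have mono : ∀ j, rayFactor l ≤ rayFactor (l + j) := by
    intro j
    induction j with
    | zero => rfl
    | succ j ih => exact ih.trans (rayFactor_mono (k := l + j) (by omega))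
  have step : ∀ j : ℕ, rayFactor (k + j) ≤ rayFactor k + j * (1 + expOne) := by
    intro j
    induction j with
    | zero => simp
    | succ j ih =>
      refine (rayFactor_succ_le (k := k + j) (by omega)).trans ((add_le_add_left ih _).trans (le_of_eq ?_))
      push_cast; ring
  have := mono (k + u - l)
  rw [Nat.add_sub_cancel' h] at this
  exact this.trans (step u)

lemma ofReal_phi {n : ℕ} (hn : 1 ≤ n) :
    ENNReal.ofReal (phi n) = 1 + 2 * rayFactor (n + 1) := by
  obtain ⟨n, rfl⟩ : ∃ k, n = k + 1 := ⟨n - 1, by omega⟩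
  rw [phi, Real.rpow_natCast, rayFactor, growth_add_two,
    ENNReal.ofReal_add zero_le_one (by positivity), ENNReal.ofReal_mul (by positivity),
    ENNReal.ofReal_mul (by positivity), ENNReal.ofReal_pow (by positivity), ENNReal.ofReal_one,
    mul_assoc]
  congr 3
  · simp
  · rw [← Nat.cast_one (R := ℝ), ← Nat.cast_add, ENNReal.ofReal_natCast]; congr 1; omega
  · push_cast; rfl

/-! ### The evolution of the queue and of the length `D` -/

lemma AdState.b_eq_growth {m : ℕ} (s : AdState m) : s.b = growth s.rays.length := rfl

/-- The remaining rays in the order in which AdSch is going to search them. -/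
def AdState.queue {m : ℕ} (s : AdState m) : List (Fin m) := s.rays.rotate s.r

namespace AdState

variable {m : ℕ}

lemma length_queue (s : AdState m) : s.queue.length = s.rays.length := List.length_rotate ..

lemma mem_queue (h : History m) (i : Fin m) : i ∈ (ofHistory h).queue ↔ i ∉ foundRays h := by
  rw [queue, List.mem_rotate, mem_rays]

lemma length_rays_add_card (h : History m) :
    (ofHistory h).rays.length + (foundRays h).card = m := by
  have : (ofHistory h).rays.toFinset = (foundRays h)ᶜ := by
    ext i; simp [mem_rays]
  rw [← List.toFinset_card_of_nodup (nodup_rays h), this, Finset.card_compl, Fintype.card_fin]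
  have := Finset.card_le_univ (foundRays h)
  rw [Fintype.card_fin] at this
  omega

lemma next_ray_eq [NeZero m] {h : History m} {a : Fin m} {q : List (Fin m)}
    (hq : (ofHistory h).queue = a :: q) (W : ℝ≥0) : ((adSch m).next W h).1 = a := by
  have h0 : (ofHistory h).rays ≠ [] := by
    intro h0; simp [queue, h0] at hq
  have hr := r_lt h h0
  have := List.head?_rotate hr
  rw [← queue, hq, List.head?_cons, List.getElem?_eq_getElem hr, Option.some.injEq] at this
  change List.getD _ _ _ = a
  rw [List.getD_eq_getElem _ _ hr, this]

lemma queue_step_of_none {h : History m} {a : Fin m} {q : List (Fin m)}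
    (hq : (ofHistory h).queue = a :: q) {e : Exploration m} (he : e.found = none) :
    (ofHistory (e :: h)).queue = q ++ [a] := by
  simp only [ofHistory, step, he, queue, Option.isSome_none, Bool.false_eq_true, if_false,
    List.rotate_mod]
  rw [← List.rotate_rotate, ← queue, hq]
  simp

lemma queue_step_of_some {h : History m} {a : Fin m} {q : List (Fin m)}
    (hq : (ofHistory h).queue = a :: q) {e : Exploration m} (hea : e.ray = a)
    (he : e.found.isSome) : (ofHistory (e :: h)).queue = q := by
  have h0 : (ofHistory h).rays ≠ [] := by
    intro h0; simp [queue, h0] at hq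
  have hr := r_lt h h0
  have nd := nodup_rays h
  simp only [ofHistory, step, he, queue, if_true, List.rotate_mod, hea]
  rw [queue, List.rotate_eq_drop_append_take hr.le, List.drop_eq_getElem_cons hr,
    List.cons_append, List.cons.injEq] at hq
  obtain ⟨rfl, rfl⟩ := hq
  rw [nd.erase_getElem, List.eraseIdx_eq_take_drop_succ]
  convert List.rotate_append_length_eq ((ofHistory h).rays.take (ofHistory h).r)
    ((ofHistory h).rays.drop ((ofHistory h).r + 1)) using 2
  simp [hr.le]

lemma D_step_of_none {h : History m} {e : Exploration m} (he : e.found = none) :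
    (ofHistory (e :: h)).D = (ofHistory h).D * growth (ofHistory h).rays.length := by
  simp [ofHistory, step, he, b_eq_growth]

lemma D_step_of_some {h : History m} {e : Exploration m} (he : e.found.isSome) :
    (ofHistory (e :: h)).D = (ofHistory h).D := by
  simp [ofHistory, step, he]

lemma one_le_D (h : History m) : 1 ≤ (ofHistory h).D := by
  induction h with
  | nil => simp [ofHistory, init]
  | cons e h ih =>
    simp only [ofHistory, step]
    split_ifs
    · exact ih
    · exact ih.trans (le_mul_of_one_le_right' (one_le_growth _))

end AdState

/-! ### The amortised bound on the distance searched by AdSch -/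

section

lemma add_le_mul_growth_pow_succ {K n : ℕ} (hK : 1 ≤ K) {P c L : ℝ≥0∞}
    (hP : P ≤ K * growth K ^ n * L) (hc : c ≤ growth K ^ (n + 1) * L) :
    P + c ≤ K * growth K ^ (n + 1) * L := by
  rw [mul_growth_pow_succ hK, add_mul]
  exact add_le_add hP hc

/-- For a target found in `S`: the left side drops by `D`, the right side by at most `L ≤ D`.
Finiteness of `D` allows the cancellation. -/
lemma le_mul_growth_pow_of_succ {K k n : ℕ} (hK : 1 ≤ K) {D X L : ℝ≥0∞} (hLD : L ≤ D)
    (hD : D ≠ ⊤) (hP : (k + 1 : ℕ) * D + X ≤ (K + 1 : ℕ) * growth (K + 1) ^ n * L) :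
    k * D + X ≤ K * growth K ^ n * L := by
  refine (ENNReal.add_le_add_iff_right hD).1 ?_
  calc k * D + X + D = (k + 1 : ℕ) * D + X := by push_cast; ring
    _ ≤ (K + 1 : ℕ) * growth (K + 1) ^ n * L := hP
    _ ≤ (K * growth K ^ n + 1) * L := by gcongr; exact mul_growth_pow_le hK n
    _ = K * growth K ^ n * L + L := by ring
    _ ≤ K * growth K ^ n * L + D := by gcongr

/-- For an unsuccessful search: the left side gains `growth k * D`, and `(k + e) + growth k ≤ (k +
e) * growth k` leaves room for it on the right. -/
lemma expand_le_mul_growth_pow {k e : ℕ} (hk : 1 ≤ k) {D X : ℝ≥0∞}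
    (hP : k * D + X ≤ (k + e : ℕ) * growth (k + e) ^ e * D) :
    k * (D * growth k) + X ≤ (k + e : ℕ) * growth (k + e) ^ e * (D * growth k) := by
  have h1 : ((k + e : ℕ) : ℝ≥0∞) + growth k ≤ (k + e : ℕ) * growth k := by
    have := mul_growth hk
    push_cast
    rw [add_mul, this, add_right_comm]
    gcongr
    exact le_mul_of_one_le_right' (one_le_growth _)
  have h2 : 1 ≤ growth (k + e) ^ e := one_le_pow₀ (one_le_growth _)
  calc k * (D * growth k) + X = (k * growth k) * D + X := by ring
    _ = (k * D + X) + growth k * D := by rw [mul_growth hk]; ring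
    _ ≤ (k + e : ℕ) * growth (k + e) ^ e * D + growth (k + e) ^ e * (growth k * D) :=
        add_le_add hP (le_mul_of_one_le_left' h2)
    _ = growth (k + e) ^ e * (((k + e : ℕ) + growth k) * D) := by ring
    _ ≤ growth (k + e) ^ e * (((k + e : ℕ) * growth k) * D) := by gcongr
    _ = _ := by ring

section Exploration

variable {m : ℕ} [NeZero m] (I : Inst m) {h : History m} {a : Fin m} {q : List (Fin m)}

lemma adSch_explore_ray (hq : (AdState.ofHistory h).queue = a :: q) :
    ((adSch m).explore I h).ray = a :=
  AdState.next_ray_eq hq I.W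

lemma adSch_explore_found (hq : (AdState.ofHistory h).queue = a :: q) :
    ((adSch m).explore I h).found =
      if I.d a ≤ (AdState.ofHistory h).D * growth (AdState.ofHistory h).rays.length ∧ I.d a ≠ ⊤
      then some (I.d a, I.w a) else none := by
  rw [← AdState.next_ray_eq hq I.W]
  rfl

lemma adSch_reach_le : reach I ((adSch m).explore I h) ≤
    (AdState.ofHistory h).D * growth (AdState.ofHistory h).rays.length := min_le_left _ _

lemma adSch_reach_le_d (hq : (AdState.ofHistory h).queue = a :: q) :
    reach I ((adSch m).explore I h) ≤ I.d a := by
  rw [← adSch_explore_ray I hq]; exact min_le_right _ _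

lemma one_le_adSch_reach : 1 ≤ reach I ((adSch m).explore I h) :=
  le_min (one_le_mul (AdState.one_le_D h) (one_le_growth _)) (I.one_le_d _)

end Exploration

open AdState

variable {m : ℕ} (I : Inst m)

/-- Accounting for the distance traversed by AdSch before the target of ray `y` is found: `L` is the
depth of the last search of ray `y`, and `X` pays for the targets found outside of `S`. -/
def SearchBound (S : Finset (Fin m)) (y : Fin m) (h : History m) : Prop :=
  ∀ pre post, (ofHistory h).queue = pre ++ y :: post → ∃ L X : ℝ≥0∞,
    L ≤ I.d y ∧ L ≤ (ofHistory h).D ∧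
    (ofHistory h).D ≤ L * growth (ofHistory h).rays.length ^ post.length ∧
    (ofHistory h).rays.length * (ofHistory h).D + X ≤
      ((ofHistory h).rays.length + (foundRays h \ S).card : ℕ) *
        growth ((ofHistory h).rays.length + (foundRays h \ S).card) ^ (foundRays h \ S).card *
        (ofHistory h).D ∧
    (ofHistory h).rays.length * (ofHistory h).D + X ≤
      ((ofHistory h).rays.length + (foundRays h \ S).card : ℕ) *
        growth ((ofHistory h).rays.length + (foundRays h \ S).card) ^
          (post.length + (foundRays h \ S).card) * L ∧
    (h.map (reach I)).sum ≤ (ofHistory h).rays.length * (ofHistory h).D + X +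
      (1 + expOne) * ∑ i ∈ foundRays h ∩ S, I.d i

lemma searchBound_nil (S : Finset (Fin m)) (y : Fin m) : SearchBound I S y [] := by
  intro pre post hq
  have hm : pre.length + 1 + post.length = m := by
    have := congrArg List.length hq
    rw [length_queue] at this
    simp [ofHistory, init] at this
    omega
  have hg0 : growth m ^ post.length ≠ 0 :=
    (zero_lt_one.trans_le (one_le_pow₀ (one_le_growth _))).ne'
  have hgt : growth m ^ post.length ≠ ⊤ :=
    ne_top_of_le_ne_top expOne_ne_top (growth_pow_le_expOne (by omega))
  have hL : (growth m ^ post.length)⁻¹ ≤ 1 := ENNReal.inv_le_one.2 (one_le_pow₀ (one_le_growth _))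
  -- The rays are treated as if they had already been searched once, to the geometric depths that
  -- lead up to `D = 1`.
  refine ⟨(growth m ^ post.length)⁻¹, 0, hL.trans (I.one_le_d y), ?_⟩
  simp only [ofHistory, init, foundRays, List.length_finRange, Finset.empty_sdiff,
    Finset.card_empty, add_zero, pow_zero, mul_one, List.map_nil, List.sum_nil, zero_le, and_true]
  refine ⟨hL, ?_, le_rfl, ?_⟩
  · rw [ENNReal.inv_mul_cancel hg0 hgt]
  · rw [mul_assoc, ENNReal.mul_inv_cancel hg0 hgt, mul_one]

variable [NeZero m]

/-- A target that has not been found lies beyond the last search of its ray. -/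
lemma D_le_mul_growth_pow (n : ℕ) (i : Fin m) (pre post : List (Fin m))
    (hq : (ofHistory ((adSch m).run I n)).queue = pre ++ i :: post) :
    (ofHistory ((adSch m).run I n)).D ≤
      I.d i * growth (ofHistory ((adSch m).run I n)).rays.length ^ post.length := by
  induction n generalizing i pre post with
  | zero =>
    exact (I.one_le_d i).trans (le_mul_of_one_le_right' (one_le_pow₀ (one_le_growth _)))
  | succ n ih =>
    simp only [Strategy.run] at hq ⊢
    set h := (adSch m).run I n with hh
    set e := (adSch m).explore I h with he
    have hlen := length_queue (ofHistory h)
    have hlen' := length_queue (ofHistory (e :: h))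
    rcases hQ : (ofHistory h).queue with _ | ⟨a, q⟩
    · have h1 : i ∈ (ofHistory (e :: h)).queue := by rw [hq]; simp
      rw [mem_queue] at h1
      have h2 : i ∈ (ofHistory h).queue := by
        rw [mem_queue]; intro h3; apply h1; simp only [foundRays]; split_ifs <;> simp [h3]
      simp [hQ] at h2
    have hf := adSch_explore_found I hQ
    rw [← he] at hf
    by_cases hc : I.d a ≤ (ofHistory h).D * growth (ofHistory h).rays.length ∧ I.d a ≠ ⊤
    · rw [if_pos hc] at hf
      have hs : e.found.isSome := by rw [hf]; rfl
      have hq' := queue_step_of_some hQ (adSch_explore_ray I hQ) hs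
      rw [hq] at hq'
      rw [D_step_of_some hs]
      refine (ih i (a :: pre) post (by rw [hQ, ← hq']; rfl)).trans ?_
      gcongr
      apply growth_antitone
      rw [← hlen', ← hlen, hq, hQ, ← hq']
      simp
    · rw [if_neg hc] at hf
      have hq' := queue_step_of_none hQ hf
      have hkk : (ofHistory (e :: h)).rays.length = (ofHistory h).rays.length := by
        rw [← hlen', ← hlen, hQ, hq']; simp
      rw [D_step_of_none hf, hkk]
      rw [hq] at hq'
      -- A ray searched in vain goes to the back of the queue. So `post = []` means that ray `i` has
      -- just been searched, and its target lies beyond the new `D`.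
      rcases List.eq_nil_or_concat post with rfl | ⟨post', b, rfl⟩
      · obtain ⟨rfl, h2⟩ := List.append_inj' hq' rfl
        simp only [List.cons.injEq, and_true] at h2
        subst h2
        rw [List.length_nil, pow_zero, mul_one]
        by_cases ht : I.d i = ⊤
        · simp [ht]
        · exact (not_le.1 fun hle => hc ⟨hle, ht⟩).le
      · rw [List.concat_eq_append, ← List.cons_append, ← List.append_assoc] at hq'
        obtain ⟨h1, -⟩ := List.append_inj' hq' rfl
        have := ih i (a :: pre) post' (by rw [hQ, ← h1]; rfl)
        rw [List.concat_eq_append, List.length_append, List.length_singleton, pow_succ,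
          ← mul_assoc]
        gcongr

/-- The bound in terms of `L` is what is needed in the end. The one in terms of `D` is carried along
because an unsuccessful search of `y` resets `L` to the new `D`. -/
lemma searchBound_cons {S : Finset (Fin m)} {y : Fin m} (hy : I.d y ≠ ⊤) (n : ℕ)
    (ih : SearchBound I S y ((adSch m).run I n)) :
    SearchBound I S y ((adSch m).run I (n + 1)) := by
  have hall := D_le_mul_growth_pow I n
  simp only [Strategy.run]
  set h := (adSch m).run I n with hh
  set e := (adSch m).explore I h with he
  intro pre post hq
  have hlen := length_queue (ofHistory h)
  have hlen' := length_queue (ofHistory (e :: h))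
  rcases hQ : (ofHistory h).queue with _ | ⟨a, q⟩
  · have h1 : y ∈ (ofHistory (e :: h)).queue := by rw [hq]; simp
    rw [mem_queue] at h1
    have h2 : y ∈ (ofHistory h).queue := by
      rw [mem_queue]; intro h3; apply h1; simp only [foundRays]; split_ifs <;> simp [h3]
    simp [hQ] at h2
  have hf := adSch_explore_found I hQ
  have hray := adSch_explore_ray I hQ
  have hr1 := adSch_reach_le I (h := h)
  have hr2 := adSch_reach_le_d I hQ
  have ha : a ∉ foundRays h := (mem_queue h a).1 (by simp [hQ])
  rw [← he] at hf hray hr1 hr2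
  have hsum : ((e :: h).map (reach I)).sum = reach I e + (h.map (reach I)).sum := by simp
  by_cases hc : I.d a ≤ (ofHistory h).D * growth (ofHistory h).rays.length ∧ I.d a ≠ ⊤
  · rw [if_pos hc] at hf
    have hs : e.found.isSome := by rw [hf]; rfl
    have hq' := queue_step_of_some hQ hray hs
    rw [hq] at hq'
    have hD := D_step_of_some (h := h) hs
    have hF : foundRays (e :: h) = insert a (foundRays h) := by simp [foundRays, hs, hray]
    have hk : (ofHistory h).rays.length = (ofHistory (e :: h)).rays.length + 1 := by
      rw [← hlen', ← hlen, hQ, hq, ← hq']; rfl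
    have hk' : (ofHistory (e :: h)).rays.length = pre.length + 1 + post.length := by
      rw [← hlen', hq]; simp; omega
    obtain ⟨L, X, hLd, hLD, hDL, hP, hPL, hT⟩ := ih (a :: pre) post (by rw [hQ, ← hq']; rfl)
    have hDt : (ofHistory h).D ≠ ⊤ := D_ne_top h (by omega)
    have haD := hall a [] q hQ
    rw [hF, hD, hsum]
    rw [hk] at hP hPL hT hDL hc hr1 haD
    set k := (ofHistory (e :: h)).rays.length
    set D := (ofHistory h).D
    have hDL' : D ≤ L * growth k ^ post.length := by
      refine hDL.trans ?_
      gcongr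
      exact growth_antitone (by omega)
    by_cases haS : a ∈ S
    · have hF1 : insert a (foundRays h) \ S = foundRays h \ S := Finset.insert_sdiff_of_mem _ haS
      have hF2 : insert a (foundRays h) ∩ S = insert a (foundRays h ∩ S) :=
        Finset.insert_inter_of_mem haS
      rw [hF1, hF2, Finset.sum_insert (by simp [ha])]
      set c := (foundRays h \ S).card
      rw [Nat.add_right_comm k 1 c] at hP hPL
      refine ⟨L, X, hLd, hLD, hDL', ?_, ?_, ?_⟩
      · exact le_mul_growth_pow_of_succ (by omega) le_rfl hDt hP
      · exact le_mul_growth_pow_of_succ (by omega) hLD hDt hPL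
      -- Ray `a` heads the queue with `k` rays behind it, so the exponent is `k`, and `growth (k +
      -- 1) ^ k ≤ e`.
      · have hDe : D ≤ expOne * I.d a := by
          refine haD.trans ?_
          rw [mul_comm]
          gcongr
          apply growth_pow_le_expOne
          rw [← hk, ← hlen, hQ]; rfl
        calc reach I e + (h.map (reach I)).sum
            ≤ I.d a + ((k + 1 : ℕ) * D + X + (1 + expOne) * ∑ i ∈ foundRays h ∩ S, I.d i) := by
              gcongr
          _ = k * D + X + (I.d a + D + (1 + expOne) * ∑ i ∈ foundRays h ∩ S, I.d i) := by
              push_cast; ring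
          _ ≤ k * D + X + (I.d a + expOne * I.d a +
              (1 + expOne) * ∑ i ∈ foundRays h ∩ S, I.d i) := by gcongr
          _ = _ := by ring
    · have hF1 : insert a (foundRays h) \ S = insert a (foundRays h \ S) :=
        Finset.insert_sdiff_of_notMem _ haS
      have hF2 : insert a (foundRays h) ∩ S = foundRays h ∩ S :=
        Finset.insert_inter_of_notMem haS
      rw [hF1, hF2, Finset.card_insert_of_notMem (by simp [ha])]
      set c := (foundRays h \ S).card
      have hK : k + (c + 1) = k + 1 + c := by omega
      rw [hK]
      -- The reserve absorbs the `D` lost by the potential. Thus `K` is unchanged, the left side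
      -- grows by the last search only, and the exponent by one.
      have hX : (k : ℝ≥0∞) * D + (X + D + reach I e) = (k + 1 : ℕ) * D + X + reach I e := by
        push_cast; ring
      refine ⟨L, X + D + reach I e, hLd, hLD, hDL', ?_, ?_, ?_⟩
      · rw [hX]
        refine add_le_mul_growth_pow_succ (by omega) hP (hr1.trans ?_)
        rw [mul_comm]
        gcongr
        simpa [add_comm 1 c] using growth_pow_le_add (k := k + 1) (p := 1) (by omega) c
      · rw [hX, ← add_assoc]
        refine add_le_mul_growth_pow_succ (by omega) hPL (hr1.trans ?_)
        have h3 := growth_pow_le_add (k := k + 1) (p := post.length + 1) (by omega) c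
        rw [Nat.add_right_comm] at h3
        calc D * growth (k + 1) ≤ L * growth (k + 1) ^ post.length * growth (k + 1) := by gcongr
          _ = L * growth (k + 1) ^ (post.length + 1) := by ring
          _ ≤ L * growth (k + 1 + c) ^ (post.length + c + 1) := by
              rw [Nat.add_right_comm post.length c 1, Nat.add_right_comm k 1 c]
              exact mul_le_mul_right h3 L
          _ = _ := mul_comm _ _
      · rw [hX]
        calc _ ≤ reach I e + ((k + 1 : ℕ) * D + X +
              (1 + expOne) * ∑ i ∈ foundRays h ∩ S, I.d i) := by gcongr
          _ = _ := by ring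
  · rw [if_neg hc] at hf
    have hq' := queue_step_of_none hQ hf
    have hkk : (ofHistory (e :: h)).rays.length = (ofHistory h).rays.length := by
      rw [← hlen', ← hlen, hQ, hq']; simp
    have hk' : (ofHistory (e :: h)).rays.length = pre.length + 1 + post.length := by
      rw [← hlen', hq]; simp; omega
    rw [hkk] at hk'
    have hF : foundRays (e :: h) = foundRays h := by simp [foundRays, hf]
    rw [D_step_of_none hf, hkk, hF, hsum]
    rw [hq] at hq'
    set k := (ofHistory h).rays.length with hkdef
    set D := (ofHistory h).D
    set c := (foundRays h \ S).card
    have hT' : ∀ X : ℝ≥0∞, (h.map (reach I)).sum ≤ k * D + X +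
        (1 + expOne) * ∑ i ∈ foundRays h ∩ S, I.d i → reach I e + (h.map (reach I)).sum ≤
        k * (D * growth k) + X + (1 + expOne) * ∑ i ∈ foundRays h ∩ S, I.d i := by
      intro X hT
      calc _ ≤ D * growth k + (k * D + X +
            (1 + expOne) * ∑ i ∈ foundRays h ∩ S, I.d i) := by gcongr
        _ = D * (k + growth k) + X + (1 + expOne) * ∑ i ∈ foundRays h ∩ S, I.d i := by ring
        _ = _ := by rw [← mul_growth (by omega)]; ring
    -- If `post = []`, the search was of `y` itself: `L` becomes its depth, and the two bounds
    -- coincide.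
    rcases List.eq_nil_or_concat post with rfl | ⟨post', b, rfl⟩
    · obtain ⟨rfl, h2⟩ := List.append_inj' hq' rfl
      simp only [List.cons.injEq, and_true] at h2
      subst h2
      obtain ⟨L, X, hLd, hLD, hDL, hP, hPL, hT⟩ := ih [] pre (by rw [hQ]; rfl)
      have hlt : D * growth k < I.d y := not_le.1 fun hle => hc ⟨hle, hy⟩
      have := expand_le_mul_growth_pow (by omega) hP
      refine ⟨D * growth k, X, hlt.le, le_rfl, by simp, this, by simpa using this, hT' X hT⟩
    · rw [List.concat_eq_append, ← List.cons_append, ← List.append_assoc] at hq'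
      obtain ⟨h1, -⟩ := List.append_inj' hq' rfl
      obtain ⟨L, X, hLd, hLD, hDL, hP, hPL, hT⟩ := ih (a :: pre) post' (by rw [hQ, ← h1]; rfl)
      have hpl : (post'.concat b).length = post'.length + 1 := by simp
      have hDb : D * growth k ≤ L * growth k ^ (post'.length + 1) := by
        rw [pow_succ, ← mul_assoc]; gcongr
      rw [hpl] at hk' ⊢
      have hkpre : k = pre.length + 1 + 1 + post'.length := by
        omega
      refine ⟨L, X, hLd, hLD.trans (le_mul_of_one_le_right' (one_le_growth _)), hDb,
        expand_le_mul_growth_pow (by omega) hP, ?_, hT' X hT⟩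
      have hX : (k : ℝ≥0∞) * (D * growth k) + X = k * D + X + D * growth k := by
        rw [mul_left_comm, mul_growth (by omega)]; ring
      rw [hX, Nat.add_right_comm]
      refine add_le_mul_growth_pow_succ (by omega) hPL (hDb.trans ?_)
      have hg := growth_pow_le_add (k := k) (p := post'.length + 1) (by omega) c
      rw [Nat.add_right_comm] at hg
      rw [mul_comm]
      exact mul_le_mul_left hg L

lemma searchBound_run {S : Finset (Fin m)} {y : Fin m} (hy : I.d y ≠ ⊤) (n : ℕ) :
    SearchBound I S y ((adSch m).run I n) := by
  induction n with
  | zero => exact searchBound_nil I S y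
  | succ n ih => exact searchBound_cons I hy n ih

end

/-! ### Competitive ratio of AdSch -/

section

namespace Strategy

variable {m : ℕ} (A : Strategy m) (I : Inst m)

lemma explore_found (h : History m) : (A.explore I h).found =
    if I.d (A.explore I h).ray ≤ (A.explore I h).depth ∧ I.d (A.explore I h).ray ≠ ⊤
    then some (I.d (A.explore I h).ray, I.w (A.explore I h).ray) else none := rfl

lemma foundWeight_explore_cons (h : History m) : foundWeight (A.explore I h :: h) =
    (if (A.explore I h).found.isSome then I.w (A.explore I h).ray else 0) + foundWeight h := by
  simp only [foundWeight, List.map_cons, List.sum_cons]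
  congr 1
  rw [explore_found]
  by_cases hc : I.d (A.explore I h).ray ≤ (A.explore I h).depth ∧ I.d (A.explore I h).ray ≠ ⊤
  · rw [if_pos hc]; rfl
  · rw [if_neg hc]; rfl

lemma sum_foundRays_le_foundWeight (n : ℕ) :
    ∑ i ∈ foundRays (A.run I n), I.w i ≤ foundWeight (A.run I n) := by
  induction n with
  | zero => simp [run, foundRays]
  | succ n ih =>
    rw [run, foundWeight_explore_cons, foundRays]
    split_ifs with hs
    · by_cases hm : (A.explore I (A.run I n)).ray ∈ foundRays (A.run I n)
      · rw [Finset.insert_eq_of_mem hm]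
        exact ih.trans le_add_self
      · rw [Finset.sum_insert hm]
        gcongr
    · rwa [zero_add]

end Strategy

lemma Inst.sum_le_setCost {m : ℕ} (I : Inst m) {S : Finset (Fin m)} (hS : S ⊆ I.targets) :
    ∑ i ∈ S, I.d i ≤ I.setCost S := by
  have h1 : S.sup I.d ≤ ∑ i ∈ S, I.d i :=
    Finset.sup_le fun i hi => Finset.single_le_sum (fun _ _ => zero_le) hi
  have h2 : ∑ i ∈ S, I.d i ≠ ⊤ := by
    rw [ENNReal.sum_ne_top]
    intro i hi
    simpa [Inst.targets] using hS hi
  refine ENNReal.le_sub_of_add_le_right (ne_top_of_le_ne_top h2 h1) ?_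
  rw [two_mul]
  gcongr

open AdState

variable {m : ℕ} [NeZero m] (I : Inst m)

lemma cast_le_sum_reach_adSch (n : ℕ) : (n : ℝ≥0∞) ≤ (((adSch m).run I n).map (reach I)).sum := by
  induction n with
  | zero => simp
  | succ n ih =>
    simp only [Strategy.run, List.map_cons, List.sum_cons]
    rw [Nat.cast_add, Nat.cast_one, add_comm]
    exact add_le_add (one_le_adSch_reach I) ih

lemma travel_adSch_le {S : Finset (Fin m)} {y : Fin m} (hy : I.d y ≠ ⊤) (n : ℕ)
    (hyf : y ∉ foundRays ((adSch m).run I n)) {K : ℕ}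
    (hK : K = (ofHistory ((adSch m).run I n)).rays.length +
      (foundRays ((adSch m).run I n) \ S).card) :
    travel I ((adSch m).run I (n + 1)) ≤ (1 + 2 * rayFactor K) * I.d y +
      2 * (1 + expOne) * ∑ i ∈ foundRays ((adSch m).run I n) ∩ S, I.d i := by
  have hmem := (mem_queue _ _).2 hyf
  obtain ⟨pre, post, hq⟩ := List.append_of_mem hmem
  obtain ⟨L, X, hLd, hLD, hDL, -, hPL, hT⟩ := searchBound_run I (S := S) hy n pre post hq
  have hlen := length_queue (ofHistory ((adSch m).run I n))
  rw [hq, List.length_append, List.length_cons] at hlen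
  simp only [Strategy.run, travel]
  set h := (adSch m).run I n
  rw [← hK] at hPL
  set c := (foundRays h \ S).card
  set P := (ofHistory h).rays.length * (ofHistory h).D + X
  set T := ∑ i ∈ foundRays h ∩ S, I.d i
  have hbound : ∀ p, p ≤ K - 1 → (K : ℝ≥0∞) * growth K ^ p * L ≤ rayFactor K * I.d y := by
    intro p hp
    unfold rayFactor
    gcongr
    exact one_le_growth _
  suffices hs : reach I ((adSch m).explore I h) + 2 * P ≤ (1 + 2 * rayFactor K) * I.d y by
    calc reach I ((adSch m).explore I h) + 2 * (h.map (reach I)).sum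
        ≤ reach I ((adSch m).explore I h) + 2 * (P + (1 + expOne) * T) := by gcongr
      _ = reach I ((adSch m).explore I h) + 2 * P + 2 * (1 + expOne) * T := by ring
      _ ≤ _ := by gcongr
  -- Either `y` is next and the last trip ends at distance at most `d y`, or the last trip is one
  -- more geometric term. In both cases the exponent of `growth K` stays at most `K - 1`.
  rcases pre with _ | ⟨a, pre⟩
  · have h1 := adSch_reach_le_d I hq
    have h2 := hPL.trans (hbound _ (by simp at hlen; omega))
    calc _ ≤ I.d y + 2 * (rayFactor K * I.d y) := add_le_add h1 (mul_le_mul_right h2 2)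
      _ = _ := by ring
  · have hkl : post.length + 1 + 1 ≤ (ofHistory h).rays.length := by simp at hlen; omega
    have h1 : reach I ((adSch m).explore I h) ≤ growth K ^ (post.length + c + 1) * L := by
      refine (adSch_reach_le I).trans ?_
      have hg := growth_pow_le_add hkl c
      rw [← hK, Nat.add_right_comm] at hg
      calc _ ≤ L * growth (ofHistory h).rays.length ^ post.length *
            growth (ofHistory h).rays.length := by gcongr
        _ = growth (ofHistory h).rays.length ^ (post.length + 1) * L := by ring
        _ ≤ _ := by gcongr
    have h2 := (add_le_mul_growth_pow_succ (by omega) hPL le_rfl).trans (hbound _ (by omega))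
    calc _ ≤ 2 * (P + growth K ^ (post.length + c + 1) * L) := by
          rw [add_comm, mul_add 2 P]
          exact add_le_add le_rfl (h1.trans (le_mul_of_one_le_left' one_le_two))
      _ ≤ 2 * (rayFactor K * I.d y) := mul_le_mul_right h2 2
      _ ≤ _ := by
          rw [add_mul, mul_assoc]
          exact le_add_self

/-- Every exploration reaches distance at least 1, whereas `travel_adSch_le` bounds the distance
uniformly as long as some target of `S` is missing. -/
lemma adSch_finds {S : Finset (Fin m)} (hS : S ⊆ I.targets) :
    ∃ n, S ⊆ foundRays ((adSch m).run I n) := by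
  by_contra! hcon
  have hd : ∑ i ∈ S, I.d i ≠ ⊤ := by
    rw [ENNReal.sum_ne_top]
    intro i hi
    simpa [Inst.targets] using hS hi
  have hR : ∀ K, K ≤ m → rayFactor K ≤ m * expOne := by
    intro K hK
    rcases Nat.eq_zero_or_pos K with rfl | hK0
    · simp [rayFactor]
    · exact mul_le_mul' (Nat.cast_le.2 hK) (growth_pow_le_expOne (by omega))
  have hC : (1 + 2 * (m * expOne)) * (∑ i ∈ S, I.d i) + 2 * (1 + expOne) * ∑ i ∈ S, I.d i ≠ ⊤ := by
    have := expOne_ne_top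
    finiteness
  obtain ⟨n, hn⟩ := ENNReal.exists_nat_gt hC
  obtain ⟨y, hyS, hyf⟩ := Finset.not_subset.1 (hcon n)
  have hy : I.d y ≠ ⊤ := by simpa [Inst.targets] using hS hyS
  have h1 := travel_adSch_le I (S := S) hy n hyf rfl
  have h2 : (n : ℝ≥0∞) ≤ travel I ((adSch m).run I (n + 1)) := by
    refine (cast_le_sum_reach_adSch I n).trans ?_
    simp only [Strategy.run, travel]
    refine le_trans ?_ le_add_self
    exact le_mul_of_one_le_left' one_le_two
  refine absurd (h2.trans (h1.trans ?_)) (not_le.2 hn)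
  gcongr
  · apply hR
    have h3 := length_rays_add_card ((adSch m).run I n)
    have h4 := Finset.card_le_card (Finset.sdiff_subset (s := foundRays ((adSch m).run I n)) (t := S))
    omega
  · exact Finset.single_le_sum (f := I.d) (fun _ _ => zero_le) hyS
  · exact Finset.inter_subset_right

lemma cost_adSch_le_setCost {S : Finset (Fin m)} (hS : S ⊆ I.targets)
    (hW : I.W ≤ ∑ i ∈ S, I.w i) {f : ℕ} (hf : f ≤ S.card) {c : ℝ≥0∞}
    (h1 : 1 + 2 * rayFactor (m - f + 1) ≤ c) (h2 : 2 * (1 + expOne) ≤ c) :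
    (adSch m).cost I ≤ c * I.setCost S := by
  classical
  have hfin : ∀ n, S ⊆ foundRays ((adSch m).run I n) → I.W ≤ foundWeight ((adSch m).run I n) :=
    fun n hn => hW.trans ((Finset.sum_le_sum_of_subset hn).trans
      ((adSch m).sum_foundRays_le_foundWeight I n))
  have hex : ∃ n, I.W ≤ foundWeight ((adSch m).run I n) := by
    obtain ⟨n, hn⟩ := adSch_finds I hS
    exact ⟨n, hfin n hn⟩
  rw [Strategy.cost, dif_pos hex]
  rcases hN : Nat.find hex with _ | n
  · simp [Strategy.run, travel]
  have hlt := Nat.find_min hex (m := n) (by omega)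
  set h := (adSch m).run I n with hh
  have hne : (S \ foundRays h).Nonempty := by
    rw [Finset.sdiff_nonempty]
    exact fun hsub => hlt (hfin n hsub)
  -- The nearest missing target is chosen so that multiples of `d y` can be charged to the other
  -- missing ones.
  obtain ⟨y, hy, hmin⟩ := Finset.exists_min_image _ I.d hne
  rw [Finset.mem_sdiff] at hy
  have hyt : I.d y ≠ ⊤ := by simpa [Inst.targets] using hS hy.1
  have hcost := travel_adSch_le I (S := S) hyt n hy.2 rfl
  rw [← hh] at hcost
  have hlen := length_rays_add_card h
  have hc1 := Finset.card_sdiff_add_card_inter (foundRays h) S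
  have hc2 := Finset.card_sdiff_add_card_inter S (foundRays h)
  rw [Finset.inter_comm] at hc2
  have hSm : S.card ≤ m := by simpa using Finset.card_le_univ S
  have hpos : 0 < (S \ foundRays h).card := hne.card_pos
  obtain ⟨u, hu⟩ : ∃ u, (S \ foundRays h).card = u + 1 := ⟨_, (Nat.sub_add_cancel hpos).symm⟩
  have hk : 1 ≤ (ofHistory h).rays.length := by
    rw [← length_queue]
    exact List.length_pos_of_mem ((mem_queue h y).2 hy.2)
  set K := (ofHistory h).rays.length + (foundRays h \ S).card
  -- Here `K = m - |foundRays h ∩ S| = m - |S| + u + 1`, and `f ≤ |S|`.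
  have hR : rayFactor K ≤ rayFactor (m - f + 1) + u * (1 + expOne) :=
    rayFactor_le_add (by omega) (by omega) (by omega)
  have hsum : (u + 1 : ℕ) * I.d y ≤ ∑ i ∈ S \ foundRays h, I.d i := by
    rw [← hu, ← nsmul_eq_mul]
    exact Finset.card_nsmul_le_sum _ _ _ hmin
  calc _ ≤ _ := hcost
    _ ≤ (1 + 2 * (rayFactor (m - f + 1) + u * (1 + expOne))) * I.d y +
        c * ∑ i ∈ foundRays h ∩ S, I.d i := by gcongr
    _ = ((1 + 2 * rayFactor (m - f + 1)) + u * (2 * (1 + expOne))) * I.d y +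
        c * ∑ i ∈ foundRays h ∩ S, I.d i := by ring
    _ ≤ (c + u * c) * I.d y + c * ∑ i ∈ foundRays h ∩ S, I.d i := by gcongr
    _ = c * ((u + 1 : ℕ) * I.d y + ∑ i ∈ foundRays h ∩ S, I.d i) := by push_cast; ring
    _ ≤ c * (∑ i ∈ S \ foundRays h, I.d i + ∑ i ∈ foundRays h ∩ S, I.d i) := by gcongr
    _ = c * ∑ i ∈ S, I.d i := by
        rw [Finset.inter_comm, add_comm, Finset.sum_inter_add_sum_sdiff]
    _ ≤ c * I.setCost S := by gcongr; exact I.sum_le_setCost hS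

lemma cost_adSch_le (hw : 0 < I.wMax) {f : ℕ} (hf : f = ⌈I.W / I.wMax⌉₊) {c : ℝ≥0∞}
    (h1 : 1 + 2 * rayFactor (m - f + 1) ≤ c) (h2 : 2 * (1 + expOne) ≤ c) :
    (adSch m).cost I ≤ c * I.opt := by
  have hc0 : c ≠ 0 := by
    rintro rfl
    simp at h1
  rcases ({S ∈ I.targets.powerset | I.W ≤ ∑ i ∈ S, I.w i} : Finset _).eq_empty_or_nonempty with
    he | hne
  · rw [Inst.opt, he, Finset.inf_empty, ENNReal.mul_top hc0]
    exact le_top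
  · obtain ⟨S, hS, hopt⟩ := Finset.exists_mem_eq_inf _ hne I.setCost
    rw [Inst.opt, hopt]
    rw [Finset.mem_filter, Finset.mem_powerset] at hS
    refine cost_adSch_le_setCost I hS.1 hS.2 ?_ h1 h2
    -- A set of weight at least `W` has at least `W / wMax` elements.
    rw [hf, Nat.ceil_le, div_le_iff₀ hw, ← nsmul_eq_mul]
    exact hS.2.trans (Finset.sum_le_card_nsmul _ _ _ fun i _ => Finset.le_sup (Finset.mem_univ i))

lemma cost_adSch_le_phi (hw : 0 < I.wMax) (hm : ⌈I.W / I.wMax⌉₊ < m) :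
    (adSch m).cost I ≤ ENNReal.ofReal (phi ((m : ℝ) - ⌈I.W / I.wMax⌉₊)) * I.opt := by
  rw [← Nat.cast_sub hm.le, ofReal_phi (by omega)]
  refine cost_adSch_le I hw rfl le_rfl ?_
  have h1 : rayFactor 1 ≤ rayFactor (m - ⌈I.W / I.wMax⌉₊ + 1) := by
    simpa using rayFactor_le_add (l := 1) (k := m - ⌈I.W / I.wMax⌉₊ + 1) (u := 0)
      (by omega) le_rfl (by omega)
  have h2 : rayFactor 2 ≤ rayFactor (m - ⌈I.W / I.wMax⌉₊ + 1) := by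
    simpa using rayFactor_le_add (l := 2) (k := m - ⌈I.W / I.wMax⌉₊ + 1) (u := 0)
      (by omega) (by omega) (by omega)
  -- At least two rays enter the factor, so the ratio is at least `1 + 2 * 4`, which exceeds `2 * (1
  -- + e)`.
  have h3 : rayFactor 2 = 4 := by
    rw [rayFactor, growth_add_two 0]
    norm_num
  rw [h3] at h2
  have he : expOne ≤ 3 := by
    rw [expOne, ← ENNReal.ofReal_ofNat]
    exact ENNReal.ofReal_le_ofReal (by linarith [Real.exp_one_lt_d9])
  calc 2 * (1 + expOne) ≤ 2 * (1 + 3) := by gcongr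
    _ ≤ 1 + 2 * 4 := by norm_num
    _ ≤ _ := by gcongr

lemma cost_adSch_le_exp (hw : 0 < I.wMax) (hm : m ≤ ⌈I.W / I.wMax⌉₊) :
    (adSch m).cost I ≤ ENNReal.ofReal (3 + 2 * Real.exp 1) * I.opt := by
  have hE : ENNReal.ofReal (3 + 2 * Real.exp 1) = 3 + 2 * expOne := by
    rw [ENNReal.ofReal_add (by norm_num) (by positivity), ENNReal.ofReal_mul (by norm_num)]
    simp [expOne]
  rw [hE]
  refine cost_adSch_le I hw rfl ?_ ?_
  · rw [Nat.sub_eq_zero_of_le hm]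
    simp only [rayFactor]
    refine le_trans ?_ le_self_add
    norm_num
  · rw [mul_add, mul_one]
    gcongr
    norm_num

end

/-! ### Growth of sequences and search of `n + 1` rays -/

/-- The minimum of `q ^ (n + 1) / (q - 1)` is attained at `q = 1 + 1 / n`; this is Bernoulli's
inequality for `q / (1 + 1 / n)`. -/
lemma mul_sub_one_le_pow {n : ℕ} (hn : 1 ≤ n) {q : ℝ} (hq : 1 ≤ q) :
    ((n : ℝ) + 1) * (1 + 1 / n) ^ n * (q - 1) ≤ q ^ (n + 1) := by
  have h0 : (0 : ℝ) < n := by exact_mod_cast hn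
  set l : ℝ := 1 + 1 / n with hl
  have hl0 : 0 < l := by positivity
  have hln : l * n = n + 1 := by rw [hl]; field_simp
  have hql : 0 < q / l := by positivity
  have bern := one_add_mul_le_pow (a := q / l - 1) (by linarith) (n + 1)
  rw [add_sub_cancel, div_pow, le_div_iff₀ (by positivity)] at bern
  refine le_trans (le_of_eq ?_) bern
  have hq' : q / l * l = q := div_mul_cancel₀ _ hl0.ne'
  push_cast
  linear_combination l ^ n * hln - l ^ n * (n + 1) * hq'

/-- A positive sequence cannot satisfy `t (k + n + 1) ≤ α (t (k + 1) - t k)` unless the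
characteristic equation `λ ^ (n + 1) = α (λ - 1)` has a positive root. -/
lemma le_of_forall_le_mul_sub {n : ℕ} (hn : 1 ≤ n) {α : ℝ} {t : ℕ → ℝ} (ht : ∀ k, 0 < t k)
    (hmono : StrictMono t) (h : ∀ k, t (k + (n + 1)) ≤ α * (t (k + 1) - t k)) :
    ((n : ℝ) + 1) * (1 + 1 / n) ^ n ≤ α := by
  by_contra! hlt
  set g := ((n : ℝ) + 1) * (1 + 1 / n) ^ n with hg
  have hα : 0 < α := by
    have h1 := (ht _).trans_le (h 0)
    exact pos_of_mul_pos_left h1 (sub_pos.2 (hmono (Nat.lt_succ_self 0))).le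
  have hbd : ∀ q : ℝ, (∀ k, q * t k ≤ t (k + 1)) → q ≤ α := by
    intro q hq
    have h1 := hq 1
    have h2 : t 2 ≤ t (0 + (n + 1)) := hmono.monotone (by omega)
    have h3 : α * (t 1 - t 0) ≤ α * t 1 := by
      gcongr
      linarith [ht 0]
    have h4 := h 0
    rw [zero_add 1] at h4
    exact le_of_mul_le_mul_right (by linarith) (ht 1)
  -- Bootstrapping: a growth rate `q` makes `t (k + n + 1)` large, and the recursion returns a
  -- better rate.
  have hstep : ∀ q : ℝ, 1 ≤ q → (∀ k, q * t k ≤ t (k + 1)) →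
      ∀ k, (1 + q ^ (n + 1) / α) * t k ≤ t (k + 1) := by
    intro q hq1 hq k
    have hpow : ∀ j, q ^ j * t k ≤ t (k + j) := by
      intro j
      induction j with
      | zero => simp
      | succ j ih =>
        calc q ^ (j + 1) * t k = q * (q ^ j * t k) := by ring
          _ ≤ q * t (k + j) := by gcongr
          _ ≤ t (k + j + 1) := hq _
    have h1 := (hpow (n + 1)).trans (h k)
    have h2 : q ^ (n + 1) / α * t k ≤ t (k + 1) - t k := by
      rw [div_mul_eq_mul_div, div_le_iff₀ hα, mul_comm _ α]
      exact h1
    linarith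
  have hg0 : 0 < g := hα.trans hlt
  have hδ : 0 < 1 / α - 1 / g := sub_pos.2 (one_div_lt_one_div_of_lt hα hlt)
  -- Each round gains at least `1 / α - 1 / g`, so the rates eventually contradict `hbd`.
  have hall : ∀ j : ℕ, ∃ q : ℝ, 1 + j * (1 / α - 1 / g) ≤ q ∧ ∀ k, q * t k ≤ t (k + 1) := by
    intro j
    induction j with
    | zero =>
      exact ⟨1, by simp, fun k => by rw [one_mul]; exact (hmono (Nat.lt_succ_self k)).le⟩
    | succ j ih =>
      obtain ⟨q, hq, hq'⟩ := ih
      have hq1 : 1 ≤ q := le_trans (by have : 0 ≤ j * (1 / α - 1 / g) := by positivity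
                                       linarith) hq
      refine ⟨_, ?_, hstep q hq1 hq'⟩
      have h1 : q - 1 ≤ q ^ (n + 1) / g := by
        rw [le_div_iff₀ hg0, mul_comm]
        exact mul_sub_one_le_pow hn hq1
      have h2 : (1 / α - 1 / g) ≤ q ^ (n + 1) * (1 / α - 1 / g) :=
        le_mul_of_one_le_left hδ.le (one_le_pow₀ hq1)
      have h3 : q ^ (n + 1) / α = q ^ (n + 1) / g + q ^ (n + 1) * (1 / α - 1 / g) := by ring
      push_cast
      linarith
  obtain ⟨j, hj⟩ := exists_nat_gt (α / (1 / α - 1 / g))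
  rw [div_lt_iff₀ hδ] at hj
  obtain ⟨q, hq, hq'⟩ := hall j
  linarith [hbd q hq']

/-- If for every threshold `d ≥ N` there is a finite set of indices in `Z` that contains those with
value below `d` and `n` further ones and that has sum at most `α * d`, then `α` is at least the
factor `(n + 1) ^ (n + 1) / n ^ n`. -/
lemma le_of_forall_threshold {n : ℕ} (hn : 1 ≤ n) {α N : ℝ} (hN : 0 < N) {Z : Set ℕ} {f : ℕ → ℝ}
    (hf : ∀ k ∈ Z, N ≤ f k)
    (h : ∀ d, N ≤ d → ∃ R : Finset ℕ, (∀ k ∈ R, k ∈ Z) ∧ (∀ k ∈ Z, f k < d → k ∈ R) ∧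
      n ≤ (R.filter fun k => d ≤ f k).card ∧ ∑ k ∈ R, f k ≤ α * d) :
    ((n : ℝ) + 1) * (1 + 1 / n) ^ n ≤ α := by
  classical
  -- Minima exist because only finitely many elements of `Z` lie below a given threshold, while `n ≥
  -- 1` provides elements above every threshold.
  have hmin : ∀ Q : Finset ℕ, ∃ a ∈ Z, a ∉ Q ∧ ∀ k ∈ Z, k ∉ Q → f a ≤ f k := by
    intro Q
    obtain ⟨d, hd⟩ : ∃ d, ∀ k ∈ Q, f k < d := by
      refine ⟨∑ k ∈ Q, |f k| + 1, fun k hk => ?_⟩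
      have := Finset.single_le_sum (f := fun k => |f k|) (fun _ _ => abs_nonneg _) hk
      have h2 := le_abs_self (f k)
      linarith
    obtain ⟨R, hRZ, -, hRn, -⟩ := h (max N d) (le_max_left _ _)
    obtain ⟨z, hz⟩ := Finset.card_pos.1 (show 0 < _ from hn.trans hRn)
    rw [Finset.mem_filter] at hz
    have hzQ : z ∉ Q := fun hq => absurd (hd z hq) (not_lt.2 ((le_max_right _ _).trans hz.2))
    obtain ⟨R', hRZ', hR', -, -⟩ := h (f z + 1) ((hf z (hRZ z hz.1)).trans (by linarith))
    obtain ⟨a, ha, hamin⟩ := Finset.exists_min_image (R' \ Q) f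
      ⟨z, Finset.mem_sdiff.2 ⟨hR' z (hRZ z hz.1) (by linarith), hzQ⟩⟩
    rw [Finset.mem_sdiff] at ha
    refine ⟨a, hRZ' a ha.1, ha.2, fun k hk hkQ => ?_⟩
    by_cases hkz : f k < f z + 1
    · exact hamin k (Finset.mem_sdiff.2 ⟨hR' k hk hkz, hkQ⟩)
    · have := hamin z (Finset.mem_sdiff.2 ⟨hR' z (hRZ z hz.1) (by linarith), hzQ⟩)
      linarith
  choose a haZ haQ hamin using hmin
  -- `Q k` consists of the first `k` elements of `Z` in an enumeration by increasing value.
  obtain ⟨Q, hQ0, hQs⟩ : ∃ Q : ℕ → Finset ℕ, Q 0 = ∅ ∧ ∀ k, Q (k + 1) = insert (a (Q k)) (Q k) :=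
    ⟨fun k => Nat.rec ∅ (fun _ q => insert (a q) q) k, rfl, fun _ => rfl⟩
  have hQZ : ∀ k, ∀ j ∈ Q k, j ∈ Z := by
    intro k
    induction k with
    | zero => simp [hQ0]
    | succ k ih =>
      intro j hj
      rw [hQs, Finset.mem_insert] at hj
      rcases hj with rfl | hj
      · exact haZ _
      · exact ih j hj
  have hcard : ∀ k, (Q k).card = k := by
    intro k
    induction k with
    | zero => simp [hQ0]
    | succ k ih => rw [hQs, Finset.card_insert_of_notMem (haQ _), ih]
  have hle : ∀ k, ∀ j ∈ Q (k + 1), f j ≤ f (a (Q k)) := by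
    intro k
    induction k with
    | zero =>
      intro j hj
      rw [hQs, hQ0, Finset.mem_insert] at hj
      rcases hj with rfl | hj
      · rw [hQ0]
      · simp at hj
    | succ k ih =>
      intro j hj
      rw [hQs, Finset.mem_insert] at hj
      rcases hj with rfl | hj
      · rfl
      · refine (ih j hj).trans (hamin _ _ (haZ _) fun hmem => haQ (Q (k + 1)) ?_)
        exact (hQs k).ge (Finset.mem_insert_of_mem hmem)
  obtain ⟨s, hs⟩ : ∃ s : ℕ → ℝ, ∀ k, s k = ∑ j ∈ Q k, f j := ⟨_, fun _ => rfl⟩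
  have hsucc : ∀ k, s (k + 1) = f (a (Q k)) + s k := by
    intro k
    rw [hs, hs, hQs, Finset.sum_insert (haQ _)]
  have hgreedy : ∀ k (R : Finset ℕ), (∀ j ∈ R, j ∈ Z) → k ≤ R.card → s k ≤ ∑ j ∈ R, f j := by
    intro k
    induction k with
    | zero =>
      intro R hR _
      rw [hs, hQ0, Finset.sum_empty]
      exact Finset.sum_nonneg fun j hj => hN.le.trans (hf j (hR j hj))
    | succ k ih =>
      intro R hR hc
      obtain ⟨r, hr, hrQ⟩ := Finset.exists_mem_notMem_of_card_lt_card
        (show (Q k).card < R.card by rw [hcard]; omega)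
      have h1 := ih (R.erase r) (fun j hj => hR j (Finset.mem_of_mem_erase hj))
        (by rw [Finset.card_erase_of_mem hr]; omega)
      have h2 := hamin (Q k) r (hR r hr) hrQ
      rw [hsucc, ← Finset.add_sum_erase R f hr]
      linarith
  have hapos : ∀ k, 0 < f (a (Q k)) := fun k => hN.trans_le (hf _ (haZ _))
  have hspos : ∀ k, 0 < s (k + 1) := by
    intro k
    induction k with
    | zero => rw [hsucc]; simpa [hs, hQ0] using hapos 0
    | succ k ih => rw [hsucc]; linarith [hapos (k + 1)]
  have hbound : ∀ k d, f (a (Q k)) < d → s (k + (n + 1)) ≤ α * d := by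
    intro k d hd
    obtain ⟨R, hRZ, hR, hRn, hRs⟩ := h d ((hf _ (haZ _)).trans hd.le)
    refine (hgreedy _ R hRZ ?_).trans hRs
    -- `R` contains the `k + 1` elements of `Q (k + 1)` below `d` and at least `n` elements not
    -- below `d`.
    rw [← Finset.card_filter_add_card_filter_not (s := R) (fun j => d ≤ f j)]
    have hsub : Q (k + 1) ⊆ R.filter fun j => ¬ d ≤ f j := by
      intro j hj
      have hjd := (hle k j hj).trans_lt hd
      exact Finset.mem_filter.2 ⟨hR j (hQZ _ j hj) hjd, not_le.2 hjd⟩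
    have := Finset.card_le_card hsub
    rw [hcard] at this
    omega
  have hα : 0 < α := by
    have h1 := (hspos (0 + n)).trans_le (hbound 0 (f (a (Q 0)) + 1) (by linarith))
    exact pos_of_mul_pos_left h1 (by linarith [hapos 0])
  -- The shift by one avoids `s 0 = 0`; consecutive differences of `t` are values of `f`.
  refine le_of_forall_le_mul_sub hn (t := fun k => s (k + 1)) hspos
    (strictMono_nat_of_lt_succ fun k => ?_) fun k => ?_
  · rw [hsucc (k + 1)]
    linarith [hapos (k + 1)]
  · rw [hsucc (k + 1), add_sub_cancel_right]
    -- `hbound` needs a threshold strictly above the value, so the threshold is let tend down to it.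
    refine le_of_forall_pos_le_add fun η hη => ?_
    have := hbound (k + 1) (f (a (Q (k + 1))) + η / α) (by linarith [div_pos hη hα])
    rw [mul_add, mul_div_cancel₀ _ hα.ne'] at this
    rwa [Nat.add_right_comm] at this

/-- If a sequence of explorations (of ray `ray k` up to depth `x k`) reaches every point at distance
`d ≥ N` on the `n + 1` rays of `B` after a total depth of at most `α * d` on these rays, then `α` is
at least the factor `(n + 1) ^ (n + 1) / n ^ n`. -/
lemma le_of_forall_reached {ι : Type*} [DecidableEq ι] {n : ℕ} (hn : 1 ≤ n) {B : Finset ι}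
    (hB : B.card = n + 1) {ray : ℕ → ι} {x : ℕ → ℝ} (hx : ∀ k, 0 ≤ x k) {α N : ℝ} (hN : 0 < N)
    (h : ∀ i ∈ B, ∀ d, N ≤ d → ∃ k, ray k = i ∧ d ≤ x k ∧ (∀ j < k, ray j = i → x j < d) ∧
      ∑ j ∈ Finset.range k with ray j ∈ B, x j ≤ α * d) :
    ((n : ℝ) + 1) * (1 + 1 / n) ^ n ≤ α := by
  classical
  -- Only record searches count: those that go deeper than every earlier search of the same ray.
  set Z : Set ℕ := {k | ray k ∈ B ∧ N ≤ x k ∧ ∀ j < k, ray j = ray k → x j < x k}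
  refine le_of_forall_threshold hn hN (Z := Z) (f := x) (fun k hk => hk.2.1) fun d hd => ?_
  have hν : ∀ i, ∃ k, i ∈ B → ray k = i ∧ d ≤ x k ∧ (∀ j < k, ray j = i → x j < d) ∧
      ∑ j ∈ Finset.range k with ray j ∈ B, x j ≤ α * d := by
    intro i
    by_cases hi : i ∈ B
    · obtain ⟨k, hk⟩ := h i hi d hd
      exact ⟨k, fun _ => hk⟩
    · exact ⟨0, fun hi' => absurd hi' hi⟩
  choose ν hν using hν
  obtain ⟨l, hl, hmax⟩ := Finset.exists_max_image B ν (Finset.card_pos.1 (by omega))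
  have hνZ : ∀ i ∈ B, ν i ∈ Z := by
    intro i hi
    obtain ⟨h1, h2, h3, -⟩ := hν i hi
    refine ⟨by rwa [h1], hd.trans h2, fun j hj hjr => (h3 j hj (hjr.trans h1)).trans_le h2⟩
  have hinj : ∀ i ∈ B, ∀ j ∈ B, ν i = ν j → i = j := by
    intro i hi j hj hij
    rw [← (hν i hi).1, ← (hν j hj).1, hij]
  -- Just before the last ray of `B` reaches `d`, all records below `d` have been made, and the
  -- other `n` rays each have a record not below `d`.
  refine ⟨(Finset.range (ν l)).filter (· ∈ Z), fun k hk => (Finset.mem_filter.1 hk).2,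
    fun k hk hkd => ?_, ?_, ?_⟩
  · refine Finset.mem_filter.2 ⟨Finset.mem_range.2 ?_, hk⟩
    obtain ⟨h1, h2, h3, -⟩ := hν (ray k) hk.1
    refine lt_of_lt_of_le ?_ (hmax (ray k) hk.1)
    by_contra! hle
    rcases hle.eq_or_lt with heq | hlt
    · rw [heq] at h2; linarith
    · linarith [hk.2.2 _ hlt h1]
  · have hsub : (B.erase l).image ν ⊆
        ((Finset.range (ν l)).filter (· ∈ Z)).filter fun k => d ≤ x k := by
      intro k hk
      obtain ⟨i, hi, rfl⟩ := Finset.mem_image.1 hk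
      rw [Finset.mem_erase] at hi
      refine Finset.mem_filter.2 ⟨Finset.mem_filter.2 ⟨Finset.mem_range.2 ?_, hνZ i hi.2⟩,
        (hν i hi.2).2.1⟩
      exact lt_of_le_of_ne (hmax i hi.2) fun heq => hi.1 (hinj i hi.2 l hl heq)
    refine le_trans (le_of_eq ?_) (Finset.card_le_card hsub)
    rw [Finset.card_image_of_injOn, Finset.card_erase_of_mem hl, hB, Nat.add_sub_cancel]
    intro i hi j hj hij
    exact hinj i (Finset.mem_of_mem_erase hi) j (Finset.mem_of_mem_erase hj) hij
  · refine le_trans (Finset.sum_le_sum_of_subset_of_nonneg ?_ fun _ _ _ => hx _) (hν l hl).2.2.2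
    intro k hk
    rw [Finset.mem_filter] at hk ⊢
    exact ⟨hk.1, hk.2.1⟩

/-! ### Simulated runs and lower bounds on the cost of a strategy -/

section

namespace Strategy

variable {m : ℕ} (A : Strategy m)

/-- The exploration that follows the history `h` if the targets are given by `d` and `w`, which need
not form a feasible instance. -/
noncomputable def simStep (W : ℝ≥0) (d : Fin m → ℝ≥0∞) (w : Fin m → ℝ≥0) (h : History m) :
    Exploration m :=
  let i := (A.next W h).1
  let l := (A.next W h).2
  { ray := i
    depth := l
    found := if d i ≤ l ∧ d i ≠ ⊤ then some (d i, w i) else none }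

/-- The first `n` explorations if the targets are given by `d` and `w`. -/
noncomputable def simulate (W : ℝ≥0) (d : Fin m → ℝ≥0∞) (w : Fin m → ℝ≥0) : ℕ → History m
  | 0 => []
  | n + 1 => A.simStep W d w (simulate W d w n) :: simulate W d w n

lemma run_eq_simulate (I : Inst m) (n : ℕ) : A.run I n = A.simulate I.W I.d I.w n := by
  induction n with
  | zero => rfl
  | succ n ih => rw [run, simulate, ih]; rfl

/-- Targets that are not reached have no influence on the first explorations. -/
lemma simulate_congr {W : ℝ≥0} {d d' : Fin m → ℝ≥0∞} {w w' : Fin m → ℝ≥0} {n : ℕ}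
    (h : ∀ k < n, ∀ i, (A.next W (A.simulate W d w k)).1 = i → (d' i = d i ∧ w' i = w i) ∨
      ((A.next W (A.simulate W d w k)).2 < d i ∨ d i = ⊤) ∧
      ((A.next W (A.simulate W d w k)).2 < d' i ∨ d' i = ⊤)) :
    A.simulate W d' w' n = A.simulate W d w n := by
  induction n with
  | zero => rfl
  | succ n ih =>
    rw [simulate, simulate, ih fun k hk => h k (by omega)]
    congr 1
    simp only [simStep, Exploration.mk.injEq, true_and]
    rcases h n (by omega) _ rfl with ⟨h1, h2⟩ | ⟨h1, h2⟩
    · rw [h1, h2]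
    · rw [if_neg, if_neg]
      · exact fun hc => h1.elim (not_lt.2 hc.1) hc.2
      · exact fun hc => h2.elim (not_lt.2 hc.1) hc.2

lemma mem_foundRays_simulate {W : ℝ≥0} {d : Fin m → ℝ≥0∞} {w : Fin m → ℝ≥0} {n : ℕ} {i : Fin m} :
    i ∈ foundRays (A.simulate W d w n) ↔ ∃ k < n, (A.next W (A.simulate W d w k)).1 = i ∧
      d i ≤ (A.next W (A.simulate W d w k)).2 ∧ d i ≠ ⊤ := by
  induction n with
  | zero => simp [simulate, foundRays]
  | succ n ih =>
    have hs : (A.simStep W d w (A.simulate W d w n)).found.isSome ↔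
        d (A.next W (A.simulate W d w n)).1 ≤ (A.next W (A.simulate W d w n)).2 ∧
          d (A.next W (A.simulate W d w n)).1 ≠ ⊤ := by
      simp only [simStep]
      split_ifs with hc
      · simpa using hc
      · simpa using hc
    have hex : ∀ P : ℕ → Prop, (∃ k < n + 1, P k) ↔ P n ∨ ∃ k < n, P k := by
      intro P
      constructor
      · rintro ⟨k, hk, hP⟩
        rcases Nat.lt_succ_iff_lt_or_eq.1 hk with hk | rfl
        · exact Or.inr ⟨k, hk, hP⟩
        · exact Or.inl hP
      · rintro (hP | ⟨k, hk, hP⟩)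
        · exact ⟨n, by omega, hP⟩
        · exact ⟨k, by omega, hP⟩
    rw [hex, ← ih, simulate, foundRays]
    by_cases hc : (A.simStep W d w (A.simulate W d w n)).found.isSome
    · rw [if_pos hc, Finset.mem_insert]
      rw [hs] at hc
      constructor
      · rintro (rfl | hi)
        · exact Or.inl ⟨rfl, hc⟩
        · exact Or.inr hi
      · rintro (⟨rfl, -⟩ | hi)
        · exact Or.inl rfl
        · exact Or.inr hi
    · rw [if_neg hc]
      rw [hs] at hc
      constructor
      · exact Or.inr
      · rintro (⟨rfl, hi⟩ | hi)
        · exact absurd hi hc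
        · exact hi

variable (I : Inst m)

lemma mem_foundRays_run {n : ℕ} {i : Fin m} :
    i ∈ foundRays (A.run I n) ↔ ∃ k < n, (A.explore I (A.run I k)).ray = i ∧
      I.d i ≤ (A.explore I (A.run I k)).depth ∧ I.d i ≠ ⊤ := by
  simp only [run_eq_simulate]
  exact A.mem_foundRays_simulate

lemma sum_map_reach_run (n : ℕ) : ((A.run I n).map (reach I)).sum =
    ∑ k ∈ Finset.range n, reach I (A.explore I (A.run I k)) := by
  induction n with
  | zero => simp [run]
  | succ n ih => rw [run, List.map_cons, List.sum_cons, ih, Finset.sum_range_succ, add_comm]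

/-- `ray_notMem` excludes repetitions only until all targets are found; afterwards `foundWeight` may
count a target twice. -/
lemma foundWeight_run_eq {n : ℕ} (h : foundRays (A.run I n) ≠ Finset.univ) :
    foundWeight (A.run I n) = ∑ i ∈ foundRays (A.run I n), I.w i := by
  induction n with
  | zero => simp [run, foundRays, foundWeight]
  | succ n ih =>
    have hmono : foundRays (A.run I n) ⊆ foundRays (A.run I (n + 1)) := by
      intro i hi
      rw [mem_foundRays_run] at hi ⊢
      obtain ⟨k, hk, hi⟩ := hi
      exact ⟨k, by omega, hi⟩
    have hn : foundRays (A.run I n) ≠ Finset.univ := by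
      intro hu
      rw [hu, Finset.univ_subset_iff] at hmono
      exact h hmono
    rw [run, foundWeight_explore_cons, ih hn, foundRays]
    split_ifs with hs
    · exact (Finset.sum_insert (A.ray_notMem I.W _ hn)).symm
    · rw [zero_add]

lemma travel_run_mono : Monotone fun n => travel I (A.run I n) := by
  refine monotone_nat_of_le_succ fun n => ?_
  rcases n with _ | n
  · simp [run, travel]
  · rw [run, run, travel, travel, sum_map_reach_run, sum_map_reach_run, Finset.sum_range_succ]
    refine le_trans ?_ le_add_self
    rw [mul_add, add_comm]
    gcongr
    exact le_mul_of_one_le_left' one_le_two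

/-- A target without which the required weight cannot be collected has to be found. -/
lemma mem_foundRays_of_le_foundWeight {n : ℕ} {i : Fin m}
    (hi : ∑ j ∈ Finset.univ.erase i, I.w j < I.W) (h : I.W ≤ foundWeight (A.run I n)) :
    i ∈ foundRays (A.run I n) := by
  by_contra hni
  rw [A.foundWeight_run_eq I fun hu => hni (by simp [hu])] at h
  refine absurd (h.trans (Finset.sum_le_sum_of_subset ?_)) (not_le.2 hi)
  intro j hj
  rw [Finset.mem_erase]
  exact ⟨fun hji => hni (hji ▸ hj), Finset.mem_univ _⟩

/-- The indispensable target `i` is found at the first search that reaches it, and every earlier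
exploration is paid for twice. -/
lemma exists_le_cost {i : Fin m} (hi : ∑ j ∈ Finset.univ.erase i, I.w j < I.W)
    (hcost : A.cost I ≠ ⊤) : ∃ k, (A.explore I (A.run I k)).ray = i ∧
      I.d i ≤ (A.explore I (A.run I k)).depth ∧
      (∀ j < k, (A.explore I (A.run I j)).ray = i → (A.explore I (A.run I j)).depth < I.d i) ∧
      I.d i + 2 * ∑ j ∈ Finset.range k, reach I (A.explore I (A.run I j)) ≤ A.cost I := by
  classical
  rw [cost] at hcost ⊢
  split_ifs at hcost ⊢ with hex
  · have hmem := A.mem_foundRays_of_le_foundWeight I hi (Nat.find_spec hex)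
    rw [mem_foundRays_run] at hmem
    obtain ⟨n, hn, hn1, hn2, hdt⟩ := hmem
    have hex' : ∃ k, (A.explore I (A.run I k)).ray = i ∧
      I.d i ≤ (A.explore I (A.run I k)).depth := ⟨n, hn1, hn2⟩
    have hkn : Nat.find hex' ≤ n := Nat.find_min' hex' ⟨hn1, hn2⟩
    obtain ⟨h1, h2⟩ := Nat.find_spec hex'
    have h3 := fun j => Nat.find_min hex' (m := j)
    set k := Nat.find hex'
    refine ⟨k, h1, h2, fun j hj hr => not_le.1 fun hd => h3 j hj ⟨hr, hd⟩, ?_⟩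
    refine le_trans (le_of_eq ?_) (A.travel_run_mono I (show k + 1 ≤ _ by omega))
    simp only [run, travel, sum_map_reach_run]
    rw [reach, h1, min_eq_right h2]
  · exact absurd rfl hcost

end Strategy

end

/-! ### Adversarial instances -/

section

/-- The instance with targets of weight one on the rays of `T`, all of which have to be found. -/
def unitInst {m : ℕ} (T : Finset (Fin m)) (d : Fin m → ℝ≥0∞) (h1 : ∀ i, 1 ≤ d i)
    (hT : ∀ i ∈ T, d i ≠ ⊤) : Inst m where
  W := T.card
  d := d
  w i := if i ∈ T then 1 else 0
  one_le_d := h1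
  w_eq_zero i hi := if_neg fun h => hT i h hi
  feasible := by simp

section UnitInst

variable {m : ℕ} {T : Finset (Fin m)} {d : Fin m → ℝ≥0∞} {h1 : ∀ i, 1 ≤ d i}
  {hT : ∀ i ∈ T, d i ≠ ⊤}

lemma wMax_unitInst (hne : T.Nonempty) : (unitInst T d h1 hT).wMax = 1 := by
  obtain ⟨i, hi⟩ := hne
  refine le_antisymm (Finset.sup_le fun j _ => ?_) ?_
  · simp only [unitInst]
    split_ifs <;> simp
  · refine le_trans (le_of_eq ?_) (Finset.le_sup (f := (unitInst T d h1 hT).w) (Finset.mem_univ i))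
    simp [unitInst, hi]

lemma div_wMax_unitInst (hne : T.Nonempty) :
    (unitInst T d h1 hT).W / (unitInst T d h1 hT).wMax = T.card := by
  rw [wMax_unitInst hne, div_one]
  rfl

lemma opt_unitInst_le : (unitInst T d h1 hT).opt ≤ 2 * ∑ i ∈ T, d i - T.sup d := by
  refine Finset.inf_le (f := (unitInst T d h1 hT).setCost) ?_
  rw [Finset.mem_filter, Finset.mem_powerset]
  refine ⟨fun i hi => ?_, ?_⟩
  · exact Finset.mem_filter.2 ⟨Finset.mem_univ i, hT i hi⟩
  · simp [unitInst]

lemma sum_erase_lt_unitInst {i : Fin m} (hi : i ∈ T) :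
    ∑ j ∈ Finset.univ.erase i, (unitInst T d h1 hT).w j < (unitInst T d h1 hT).W := by
  have : ∑ j ∈ Finset.univ.erase i, (unitInst T d h1 hT).w j = ((T.erase i).card : ℝ≥0) := by
    simp only [unitInst, Finset.sum_boole]
    congr 2
    ext j
    simp [and_comm]
  rw [this]
  simp only [unitInst]
  exact_mod_cast Finset.card_erase_lt_of_mem hi

end UnitInst

variable {m : ℕ} (A : Strategy m)

/-- If all the targets are required and none is found during the first `n` explorations, then a
strategy has to pay for these explorations and for reaching every target, in both directions except
for one target. -/
lemma exists_le_cost_of_foundRays_eq_empty [NeZero m] (I : Inst m)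
    (hI : ∀ i, ∑ j ∈ Finset.univ.erase i, I.w j < I.W) (hcost : A.cost I ≠ ⊤) {n : ℕ}
    (hn : foundRays (A.run I n) = ∅) : ∃ l, 2 * ∑ i, I.d i +
      2 * ∑ k ∈ Finset.range n, reach I (A.explore I (A.run I k)) ≤ A.cost I + I.d l := by
  classical
  have hν : ∀ i, ∃ k, n ≤ k ∧ (A.explore I (A.run I k)).ray = i ∧
      reach I (A.explore I (A.run I k)) = I.d i ∧
      I.d i + 2 * ∑ j ∈ Finset.range k, reach I (A.explore I (A.run I j)) ≤ A.cost I := by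
    intro i
    obtain ⟨k, h1, h2, -, h4⟩ := A.exists_le_cost I (hI i) hcost
    refine ⟨k, ?_, h1, by rw [reach, h1, min_eq_right h2], h4⟩
    by_contra! hkn
    have : i ∈ foundRays (A.run I n) := (A.mem_foundRays_run I).2 ⟨k, hkn, h1, h2, ?_⟩
    · simp [hn] at this
    · exact ne_top_of_le_ne_top hcost (le_self_add.trans h4)
  choose ν hν1 hν2 hν3 hν4 using hν
  -- Ray `l` carries the target found last. The first `n` explorations and the discoveries of the
  -- other targets are distinct explorations before that.
  obtain ⟨l, -, hl⟩ := Finset.exists_max_image Finset.univ ν ⟨0, Finset.mem_univ _⟩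
  refine ⟨l, ?_⟩
  have hinj : Function.Injective ν := fun i j hij => by rw [← hν2 i, ← hν2 j, hij]
  have hdisj : Disjoint (Finset.range n) ((Finset.univ.erase l).image ν) := by
    rw [Finset.disjoint_left]
    intro k hk hk'
    obtain ⟨i, -, rfl⟩ := Finset.mem_image.1 hk'
    exact absurd (Finset.mem_range.1 hk) (not_lt.2 (hν1 i))
  have hsub : Finset.range n ∪ (Finset.univ.erase l).image ν ⊆ Finset.range (ν l) := by
    refine Finset.union_subset (Finset.range_subset_range.2 (hν1 l)) fun k hk => ?_
    obtain ⟨i, hi, rfl⟩ := Finset.mem_image.1 hk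
    exact Finset.mem_range.2 (lt_of_le_of_ne (hl i (Finset.mem_univ i))
      fun h => (Finset.mem_erase.1 hi).1 (hinj h))
  have hsum := Finset.sum_le_sum_of_subset (f := fun k => reach I (A.explore I (A.run I k))) hsub
  rw [Finset.sum_union hdisj, Finset.sum_image hinj.injOn,
    Finset.sum_congr rfl fun i _ => hν3 i] at hsum
  rw [← Finset.add_sum_erase _ I.d (Finset.mem_univ l)]
  calc 2 * (I.d l + ∑ i ∈ Finset.univ.erase l, I.d i) +
        2 * ∑ k ∈ Finset.range n, reach I (A.explore I (A.run I k))
      = (I.d l + 2 * (∑ k ∈ Finset.range n, reach I (A.explore I (A.run I k)) +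
        ∑ i ∈ Finset.univ.erase l, I.d i)) + I.d l := by ring
    _ ≤ (I.d l + 2 * ∑ k ∈ Finset.range (ν l), reach I (A.explore I (A.run I k))) + I.d l := by
        gcongr
    _ ≤ A.cost I + I.d l := by gcongr; exact hν4 l

/-- If all the targets are required, then no strategy beats the ratio two. -/
lemma exists_two_mul_opt_le_cost [NeZero m] (hm : 2 ≤ m) :
    ∃ I : Inst m, 0 < I.wMax ∧ I.W / I.wMax = m ∧ 2 * I.opt ≤ A.cost I := by
  classical
  have hne : (Finset.univ : Finset (Fin m)).Nonempty := ⟨0, Finset.mem_univ _⟩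
  have hall : ∀ d h1 hT, 0 < (unitInst (m := m) Finset.univ d h1 hT).wMax ∧
      (unitInst (m := m) Finset.univ d h1 hT).W / (unitInst Finset.univ d h1 hT).wMax = m := by
    intro d h1 hT
    exact ⟨by rw [wMax_unitInst hne]; exact one_pos, by rw [div_wMax_unitInst hne]; simp⟩
  -- The strategy is observed while it finds nothing.
  set h := A.simulate m (fun _ => ⊤) (fun _ => 1)
  set ray : ℕ → Fin m := fun k => (A.next m (h k)).1 with hray
  set depth : ℕ → ℝ≥0∞ := fun k => (A.next m (h k)).2 with hdepth
  have hfound : ∀ k, foundRays (h k) = ∅ := by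
    intro k
    rw [Finset.eq_empty_iff_forall_notMem]
    intro i hi
    obtain ⟨-, -, -, -, hi⟩ := A.mem_foundRays_simulate.1 hi
    exact hi rfl
  have hdt : ∀ k, depth k ≠ ⊤ := by
    intro k
    have : Nontrivial (Fin m) := Fin.nontrivial_iff_two_le.2 hm
    obtain ⟨i, hi⟩ := exists_ne (ray k)
    exact A.depth_ne_top _ _ ⟨i, by simp [hfound], hi⟩
  have hsim : ∀ d h1 hT n, (∀ k < n, depth k < d (ray k)) →
      A.run (unitInst Finset.univ d h1 hT) n = h n := by
    intro d h1 hT n hd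
    rw [Strategy.run_eq_simulate]
    have hW : (unitInst (m := m) Finset.univ d h1 hT).W = m := by simp [unitInst]
    rw [hW]
    refine A.simulate_congr fun k hk i hi => Or.inr ⟨Or.inr rfl, Or.inl ?_⟩
    rw [← hi]
    exact hd k hk
  -- Hiding each target at `L i + 1` wastes `∑ L = ∑ d - m`. The loss `2 * m` against the ratio two
  -- is made up for by one target at distance at least `2 * m`. If no search is that deep, targets
  -- at distance `2 * m` are never found.
  by_cases hbig : ∃ k, (2 * m : ℕ) ≤ depth k
  · obtain ⟨n, hn⟩ := hbig
    set L : Fin m → ℝ≥0∞ := fun i => ∑ k ∈ Finset.range (n + 1) with ray k = i, depth k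
    have hL : ∀ k < n + 1, depth k ≤ L (ray k) := fun k hk =>
      Finset.single_le_sum (f := depth) (fun _ _ => zero_le)
        (Finset.mem_filter.2 ⟨Finset.mem_range.2 hk, rfl⟩)
    have hLt : ∀ i, L i ≠ ⊤ := fun i => ENNReal.sum_ne_top.2 fun k _ => hdt k
    have hlt : ∀ k < n + 1, depth k < L (ray k) + 1 := fun k hk =>
      (hL k hk).trans_lt (ENNReal.lt_add_right (hLt _) one_ne_zero)
    have h1 : ∀ i, 1 ≤ L i + 1 := fun i => le_add_self
    have hT : ∀ i ∈ Finset.univ, L i + 1 ≠ ⊤ := fun i _ =>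
      ENNReal.add_ne_top.2 ⟨hLt i, ENNReal.one_ne_top⟩
    set I := unitInst Finset.univ (fun i => L i + 1) h1 hT with hI
    refine ⟨I, (hall _ h1 hT).1, (hall _ h1 hT).2, ?_⟩
    by_cases hcost : A.cost I = ⊤
    · rw [hcost]; exact le_top
    have hrun : ∀ k ≤ n + 1, A.run I k = h k := fun k hk =>
      hsim _ h1 hT k fun j hj => hlt j (by omega)
    obtain ⟨l, hl⟩ := exists_le_cost_of_foundRays_eq_empty A I
      (fun i => sum_erase_lt_unitInst (Finset.mem_univ i)) hcost (n := n + 1)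
      (by rw [hrun _ le_rfl, hfound])
    have hreach : ∑ k ∈ Finset.range (n + 1), reach I (A.explore I (A.run I k)) = ∑ i, L i := by
      rw [Finset.sum_fiberwise]
      refine Finset.sum_congr rfl fun k hk => ?_
      rw [Finset.mem_range] at hk
      rw [hrun k hk.le]
      have hW : I.W = m := by simp [hI, unitInst]
      simp only [reach, Strategy.explore, hW]
      exact min_eq_left (hlt k hk).le
    have hsum : ∑ i, I.d i = ∑ i, L i + m := by
      simp [hI, unitInst, Finset.sum_add_distrib]
    have hd : ∀ i, I.d i ≤ Finset.univ.sup I.d := fun i => Finset.le_sup (Finset.mem_univ i)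
    have hsup : 2 * (m : ℝ≥0∞) ≤ Finset.univ.sup I.d := by
      refine le_trans ?_ (hd (ray n))
      have := hn.trans (hlt n (by omega)).le
      push_cast at this
      exact this
    have hopt : I.opt ≤ 2 * ∑ i, I.d i - Finset.univ.sup I.d := opt_unitInst_le
    rw [hreach] at hl
    calc 2 * I.opt ≤ 2 * (2 * ∑ i, I.d i - Finset.univ.sup I.d) := by gcongr
      _ = 2 * (2 * ∑ i, I.d i) - 2 * Finset.univ.sup I.d := ENNReal.mul_sub fun _ _ => by simp
      _ ≤ A.cost I := by
          rw [tsub_le_iff_right]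
          calc 2 * (2 * ∑ i, I.d i) = 2 * ∑ i, I.d i + 2 * ∑ i, L i + 2 * m := by
                rw [hsum]; ring
            _ ≤ A.cost I + I.d l + Finset.univ.sup I.d := by gcongr
            _ ≤ A.cost I + Finset.univ.sup I.d + Finset.univ.sup I.d := by gcongr; exact hd l
            _ = _ := by ring
  · push Not at hbig
    have h1 : ∀ i : Fin m, (1 : ℝ≥0∞) ≤ (2 * m : ℕ) := fun _ => by
      exact_mod_cast (show 1 ≤ 2 * m by omega)
    have hT : ∀ i ∈ (Finset.univ : Finset (Fin m)), ((2 * m : ℕ) : ℝ≥0∞) ≠ ⊤ := fun _ _ =>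
      ENNReal.natCast_ne_top _
    refine ⟨unitInst Finset.univ (fun _ => (2 * m : ℕ)) h1 hT, (hall _ h1 hT).1,
      (hall _ h1 hT).2, ?_⟩
    suffices hcost : A.cost (unitInst Finset.univ (fun _ => (2 * m : ℕ)) h1 hT) = ⊤ by
      rw [hcost]; exact le_top
    by_contra hcost
    obtain ⟨k, -, hk, -⟩ := A.exists_le_cost _ (sum_erase_lt_unitInst (Finset.mem_univ 0)) hcost
    rw [hsim _ h1 hT k fun j _ => hbig j] at hk
    refine absurd hk (not_le.2 ?_)
    have hW : (unitInst (m := m) Finset.univ (fun _ => (2 * m : ℕ)) h1 hT).W = m := by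
      simp [unitInst]
    simp only [Strategy.explore, hW]
    exact hbig k

/-- If `t < m` targets of equal weight are required, then no strategy beats the ratio
`phi (m - t)`. -/
lemma exists_phi_mul_opt_le_cost {t : ℕ} (ht : 1 ≤ t) (htm : t < m) {ε : ℝ} (hε : 0 < ε) :
    ∃ I : Inst m, 0 < I.wMax ∧ I.W / I.wMax = t ∧
      ENNReal.ofReal (phi ((m : ℝ) - t) - ε) * I.opt ≤ A.cost I := by
  classical
  by_contra! hcon
  set c := phi ((m : ℝ) - t) - ε with hc
  set F : Finset (Fin m) := {r | r.val < t - 1} with hF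
  have hFcard : F.card = t - 1 := by
    rw [hF, Fin.card_filter_val_lt, min_eq_right (by omega)]
  set d : Fin m → ℝ → Fin m → ℝ≥0∞ := fun i x r =>
    if r ∈ F then 1 else if r = i then ENNReal.ofReal x else ⊤ with hd
  have h1 : ∀ i x, 1 ≤ x → ∀ r, 1 ≤ d i x r := by
    intro i x hx r
    simp only [hd]
    split_ifs
    · rfl
    · rw [← ENNReal.ofReal_one]; exact ENNReal.ofReal_le_ofReal hx
    · exact le_top
  have hT : ∀ i x, ∀ r ∈ insert i F, d i x r ≠ ⊤ := by
    intro i x r hr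
    simp only [hd]
    rw [Finset.mem_insert] at hr
    split_ifs with hrF hri
    · exact ENNReal.one_ne_top
    · exact ENNReal.ofReal_ne_top
    · exact absurd hr (by tauto)
  -- The run in which the far target is absent; a far target leaves it unchanged until it is
  -- reached.
  set h := A.simulate t (fun r => if r ∈ F then 1 else ⊤) (fun r => if r ∈ F then 1 else 0) with hh
  set ray : ℕ → Fin m := fun k => (A.next t (h k)).1 with hray
  set depth : ℕ → ℝ≥0∞ := fun k => (A.next t (h k)).2 with hdepth
  have hdt : ∀ k, depth k ≠ ⊤ := by
    intro k
    have hnot : ∀ i, i ∉ F → i ∉ foundRays (h k) := by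
      intro i hi hif
      obtain ⟨-, -, -, -, hi'⟩ := A.mem_foundRays_simulate.1 hif
      simp [hi] at hi'
    -- Two rays outside `F` are never exhausted, so all depths are finite.
    have hF1 : (⟨t - 1, by omega⟩ : Fin m) ∉ F := by simp [hF]
    have hF2 : (⟨t, htm⟩ : Fin m) ∉ F := by simp [hF]
    refine A.depth_ne_top _ _ ?_
    by_cases hr : (⟨t, htm⟩ : Fin m) = ray k
    · refine ⟨_, hnot _ hF1, fun hr' => ?_⟩
      have := congrArg Fin.val (hr.trans hr'.symm)
      simp only at this
      omega
    · exact ⟨_, hnot _ hF2, hr⟩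
  have key : ∀ i ∉ F, ∀ x : ℝ, 1 ≤ x → 0 < c ∧ ∃ k, ray k = i ∧ x ≤ (depth k).toReal ∧
      (∀ j < k, ray j = i → (depth j).toReal < x) ∧
      x + 2 * ∑ j ∈ Finset.range k with ray j ∈ Fᶜ, (depth j).toReal ≤ c * (2 * (t - 1) + x) := by
    intro i hi x hx
    have hcard : (insert i F).card = t := by rw [Finset.card_insert_of_notMem hi, hFcard]; omega
    have hne : (insert i F).Nonempty := Finset.insert_nonempty _ _
    have hW : (unitInst (insert i F) (d i x) (h1 i x hx) (hT i x)).W = t := by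
      simp [unitInst, hcard]
    have hlt := hcon (unitInst (insert i F) (d i x) (h1 i x hx) (hT i x))
      (by rw [wMax_unitInst hne]; exact one_pos) (by rw [div_wMax_unitInst hne, hcard])
    set I := unitInst (insert i F) (d i x) (h1 i x hx) (hT i x) with hI
    have hdi : I.d i = ENNReal.ofReal x := by simp [hI, unitInst, hd, hi]
    -- For `c ≤ 0` the truncation `ENNReal.ofReal c` is `0`, and no cost lies below `0`.
    have hc0 : 0 < c := by
      by_contra! hc0
      rw [ENNReal.ofReal_eq_zero.2 hc0, zero_mul] at hlt
      exact not_lt_zero hlt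
    refine ⟨hc0, ?_⟩
    obtain ⟨k, hk1, hk2, hk3, hk4⟩ := A.exists_le_cost I
      (sum_erase_lt_unitInst (Finset.mem_insert_self i F)) hlt.ne_top
    have hrun : ∀ j ≤ k, A.run I j = h j := by
      intro j hj
      rw [hh, ← hW, Strategy.run_eq_simulate]
      symm
      refine A.simulate_congr fun l hl r hr => ?_
      rw [← Strategy.run_eq_simulate] at hr ⊢
      by_cases hrF : r ∈ F
      · left
        simp [hI, unitInst, hd, hrF]
      · by_cases hri : r = i
        · right
          subst hri
          exact ⟨Or.inl (hk3 l (by omega) hr), Or.inr (by simp [hrF])⟩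
        · left
          simp [hI, unitInst, hd, hrF, hri]
    have hexp : ∀ j ≤ k, (A.explore I (A.run I j)).ray = ray j ∧
        (A.explore I (A.run I j)).depth = depth j := by
      intro j hj
      rw [hrun j hj]
      simp only [Strategy.explore, hW]
      exact ⟨rfl, rfl⟩
    have hk3' : ∀ j < k, ray j = i → depth j < ENNReal.ofReal x := by
      intro j hj hji
      have := hk3 j hj ((hexp j hj.le).1.trans hji)
      rwa [(hexp j hj.le).2, hdi] at this
    refine ⟨k, by rw [← (hexp k le_rfl).1, hk1], ?_, fun j hj hji => ?_, ?_⟩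
    · rwa [(hexp k le_rfl).2, hdi, ENNReal.ofReal_le_iff_le_toReal (hdt k)] at hk2
    · rw [← ENNReal.lt_ofReal_iff_toReal_lt (hdt j)]
      exact hk3' j hj hji
    · have hreach : ∑ j ∈ Finset.range k with ray j ∈ Fᶜ, depth j ≤
          ∑ j ∈ Finset.range k, reach I (A.explore I (A.run I j)) := by
        refine le_trans (Finset.sum_le_sum fun j hj => ?_)
          (Finset.sum_le_sum_of_subset (Finset.filter_subset (fun j => ray j ∈ Fᶜ) _))
        rw [Finset.mem_filter, Finset.mem_range, Finset.mem_compl] at hj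
        rw [reach, (hexp j hj.1.le).1, (hexp j hj.1.le).2]
        refine le_min le_rfl ?_
        by_cases hji : ray j = i
        · rw [hji, hdi]
          exact (hk3' j hj.1 hji).le
        · simp [hI, unitInst, hd, hj.2, hji]
      have hopt : I.opt ≤ ENNReal.ofReal (2 * (t - 1) + x) := by
        refine opt_unitInst_le.trans ?_
        have ht0 : (0 : ℝ) ≤ t - 1 := by
          have : (1 : ℝ) ≤ t := by exact_mod_cast ht
          linarith
        have hsF : ∑ r ∈ F, d i x r = ENNReal.ofReal (t - 1) := by
          rw [Finset.sum_congr rfl fun r hr => show d i x r = 1 by simp [hd, hr]]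
          rw [Finset.sum_const, hFcard, nsmul_one, ← Nat.cast_one (R := ℝ), ← Nat.cast_sub ht,
            ENNReal.ofReal_natCast]
        have hdi' : d i x i = ENNReal.ofReal x := hdi
        have hsup : ENNReal.ofReal x ≤ (insert i F).sup (d i x) := by
          rw [← hdi']
          exact Finset.le_sup (Finset.mem_insert_self i F)
        rw [Finset.sum_insert hi, hsF, hdi', tsub_le_iff_right,
          ENNReal.ofReal_add (by linarith) (by linarith), ENNReal.ofReal_mul zero_le_two,
          ENNReal.ofReal_ofNat]
        calc 2 * (ENNReal.ofReal x + ENNReal.ofReal (t - 1))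
            = 2 * ENNReal.ofReal (t - 1) + ENNReal.ofReal x + ENNReal.ofReal x := by ring
          _ ≤ _ := by gcongr
      have hS0 : 0 ≤ ∑ j ∈ Finset.range k with ray j ∈ Fᶜ, (depth j).toReal :=
        Finset.sum_nonneg fun _ _ => ENNReal.toReal_nonneg
      have hS : ENNReal.ofReal (∑ j ∈ Finset.range k with ray j ∈ Fᶜ, (depth j).toReal) =
          ∑ j ∈ Finset.range k with ray j ∈ Fᶜ, depth j := by
        rw [ENNReal.ofReal_sum_of_nonneg fun _ _ => ENNReal.toReal_nonneg]
        exact Finset.sum_congr rfl fun j _ => ENNReal.ofReal_toReal (hdt j)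
      have hx0 : 0 ≤ x := by linarith
      have htop : 0 ≤ c * (2 * (t - 1) + x) := by
        have : (1 : ℝ) ≤ t := by exact_mod_cast ht
        exact mul_nonneg hc0.le (by linarith)
      rw [← ENNReal.ofReal_le_ofReal_iff htop, ENNReal.ofReal_add hx0 (by positivity),
        ENNReal.ofReal_mul zero_le_two, ENNReal.ofReal_ofNat, hS, ENNReal.ofReal_mul hc0.le]
      calc _ ≤ I.d i + 2 * ∑ j ∈ Finset.range k, reach I (A.explore I (A.run I j)) := by
            rw [hdi]; gcongr
        _ ≤ A.cost I := hk4
        _ ≤ _ := hlt.le.trans (by gcongr)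
  have hc0 : 0 < c := (key ⟨t, htm⟩ (by simp [hF]) 1 le_rfl).1
  have ht1 : (1 : ℝ) ≤ t := by exact_mod_cast ht
  -- Beyond this distance the contribution `c * (t - 1)` of the near targets is at most `ε / 4 * x`.
  -- Half of the slack `ε / 2` in `(c - 1) / 2` then remains for the contradiction.
  have hN : (1 : ℝ) ≤ 1 + 4 * c * t / ε := by
    have : 0 ≤ 4 * c * t / ε := by positivity
    linarith
  have hcardB : Fᶜ.card = (m - t) + 1 := by
    rw [Finset.card_compl, hFcard, Fintype.card_fin]; omega
  have hfin := le_of_forall_reached (n := m - t) (by omega) hcardB (ray := ray)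
    (x := fun k => (depth k).toReal) (fun _ => ENNReal.toReal_nonneg)
    (α := (c - 1) / 2 + ε / 4) (zero_lt_one.trans_le hN) fun i hi x hx => by
      obtain ⟨-, k, hk1, hk2, hk3, hk4⟩ := key i (Finset.mem_compl.1 hi) x (hN.trans hx)
      refine ⟨k, hk1, hk2, hk3, ?_⟩
      have hbound : 4 * c * t ≤ ε * x := by
        have h2 : 4 * c * t / ε ≤ x := by linarith
        rwa [div_le_iff₀ hε, mul_comm x] at h2
      linarith
  have hphi : c = 1 + 2 * (((m - t : ℕ) : ℝ) + 1) * (1 + 1 / ((m - t : ℕ) : ℝ)) ^ (m - t) - ε := by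
    rw [hc, ← Nat.cast_sub htm.le, phi, Real.rpow_natCast, add_comm (1 : ℝ) ((m - t : ℕ) : ℝ)]
  linarith

end

end WeightedSearch

open WeightedSearch in
theorem theorem2 (m : ℕ) [NeZero m] :
    (∀ I : Inst m, 0 < I.wMax →
      (⌈I.W / I.wMax⌉₊ < m →
        (adSch m).cost I ≤ ENNReal.ofReal (phi ((m : ℝ) - ⌈I.W / I.wMax⌉₊)) * I.opt) ∧
      (m ≤ ⌈I.W / I.wMax⌉₊ →
        (adSch m).cost I ≤ ENNReal.ofReal (3 + 2 * Real.exp 1) * I.opt)) ∧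
    (2 ≤ m → ∀ A : Strategy m,
      (∀ t : ℕ, 1 ≤ t → t < m → ∀ ε : ℝ, 0 < ε →
        ∃ I : Inst m, 0 < I.wMax ∧ I.W / I.wMax < m ∧ ⌈I.W / I.wMax⌉₊ = t ∧
          ENNReal.ofReal (phi ((m : ℝ) - ⌈I.W / I.wMax⌉₊) - ε) * I.opt ≤ A.cost I) ∧
      (∃ I : Inst m, 0 < I.wMax ∧ I.W / I.wMax = m ∧ 2 * I.opt ≤ A.cost I)) := by
  refine ⟨fun I hw => ⟨cost_adSch_le_phi I hw, cost_adSch_le_exp I hw⟩, fun hm A =>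
    ⟨fun t ht htm ε hε => ?_, exists_two_mul_opt_le_cost A hm⟩⟩
  obtain ⟨I, hw, hW, hI⟩ := exists_phi_mul_opt_le_cost A ht htm hε
  have hceil : ⌈I.W / I.wMax⌉₊ = t := by rw [hW, Nat.ceil_natCast]
  refine ⟨I, hw, ?_, hceil, ?_⟩
  · rw [hW]
    exact_mod_cast htm
  · rwa [hceil]
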